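/- Let $(\Omega,\mathcal F,\mathbb P)$ be a complete probability space with a $\mathbb P$-preserving transformation $\vartheta$, let $(X,d)$ be a compact metric space with Borel $\sigma$-algebra $\mathcal B$, and let $\mathcal E\subset\Omega\times X$ be $\mathcal F\otimes\mathcal B$-measurable with all fibers $\mathcal E_\omega=\{x:(\omega,x)\in\mathcal E\}$ nonempty and compact. Let $T$ be a continuous bundle RDS on $\mathcal E$: maps $T_\omega:\mathcal E_\omega\to\mathcal E_{\vartheta\omega}$ such that $(\omega,x)\mapsto T_\omega x$ is measurable on $\mathcal E$ and $T_\omega$ is continuous for $\mathbb P$-almost every $\omega$. Put $\Theta(\omega,x)=(\vartheta\omega,T_\omega x)$ on $\mathcal E$, $T^0_\omega=\mathrm{id}$ and $T^n_\omega=T_{\vartheta^{n-1}\omega}\circ\dots\circ T_\omega$. Let $\mathcal I_{\mathbb P}(\mathcal E)$ be the set of $\Theta$-invariant probability measures $\mu$ on $\Omega\times X$ with marginal $\mathbb P$ on $\Omega$ and $\mu(\mathcal E)=1$; $T$ is called uniquely ergodic if $\mathcal I_{\mathbb P}(\mathcal E)$ consists of exactly one measure. A Borel set $E\subset X$ is called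 small if, for $\mathbb P$-almost every $\omega$, \[\lim_{n\to\infty}\frac1n\sup_{x\in\mathcal E_\omega}\sum_{i=0}^{n-1}1_E(T^i_\omega x)=0 .\] $T$ has the small boundary property (SBP) if for every $x\in X$ and every open $U\ni x$ there is a neighborhood $V\subset U$ of $x$ whose boundary $\partial V$ is small. Suppose that $\mathbb P$ is $\vartheta$-ergodic and that $T$ is uniquely ergodic, with $\mathcal I_{\mathbb P}(\mathcal E)=\{\mu\}$. Then $T$ has the SBP. Moreover, for every $x\in X$: $\mu(\Omega\times\{y:d(x,y)=r\})\neq0$ for at most countably many $r>0$; the sphere $\{y:d(x,y)=r\}$ fails to be small for at most countably many $r>0$; and for every $\varepsilon>0$ there is $r\in(0,\varepsilon)$ such that the ball $\{y:d(x,y)<r\}$ has small boundary. -/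

import Mathlib

open MeasureTheory Filter Topology Set

/-- A continuous bundle random dynamical system over `(Ω, P, ϑ)` with state space `X`:
a measurable set `graph ⊆ Ω × X` with nonempty compact fibres `E_ω`, and maps
`T_ω : E_ω → E_{ϑ ω}` which are jointly measurable in `(ω, x)` on `graph` and continuous for
`P`-almost every `ω`. -/
structure BundleRDS {Ω : Type*} [MeasurableSpace Ω] (X : Type*) [TopologicalSpace X]
    [MeasurableSpace X] (P : Measure Ω) (ϑ : Ω → Ω) where
  /-- the base transformation preserves `P` -/
  base_measurePreserving : MeasurePreserving ϑ P P
  /-- the bundle, as a subset of the product -/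
  graph : Set (Ω × X)
  measurableSet_graph : MeasurableSet graph
  fiber_nonempty : ∀ ω, {x : X | (ω, x) ∈ graph}.Nonempty
  fiber_isCompact : ∀ ω, IsCompact {x : X | (ω, x) ∈ graph}
  /-- the random transformation -/
  map : (ω : Ω) → {x : X | (ω, x) ∈ graph} → {x : X | (ϑ ω, x) ∈ graph}
  measurable_map : Measurable fun p : graph => (map p.1.1 ⟨p.1.2, p.2⟩ : X)
  continuous_map : ∀ᵐ ω ∂P, Continuous (map ω)

namespace BundleRDS

variable {Ω : Type*} [MeasurableSpace Ω] {X : Type*} [TopologicalSpace X] [MeasurableSpace X]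
  {P : Measure Ω} {ϑ : Ω → Ω}

/-- The fibre `E_ω`. -/
def fiber (T : BundleRDS X P ϑ) (ω : Ω) : Set X := {x : X | (ω, x) ∈ T.graph}

/-- The skew product `Θ (ω, x) = (ϑ ω, T_ω x)` on the bundle. -/
def skew (T : BundleRDS X P ϑ) (p : T.graph) : T.graph :=
  ⟨(ϑ p.1.1, T.map p.1.1 ⟨p.1.2, p.2⟩), (T.map p.1.1 ⟨p.1.2, p.2⟩).2⟩

/-- The cocycle `T^n_ω = T_{ϑ^{n-1} ω} ∘ ⋯ ∘ T_{ϑ ω} ∘ T_ω : E_ω → E_{ϑ^n ω}`. -/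
def iter (T : BundleRDS X P ϑ) : (n : ℕ) → (ω : Ω) → T.fiber ω → T.fiber (ϑ^[n] ω)
  | 0, _, x => x
  | n + 1, ω, x => T.iter n (ϑ ω) (T.map ω x)

theorem skew_iterate (T : BundleRDS X P ϑ) (n : ℕ) (ω : Ω) (x : T.fiber ω) :
    (T.skew^[n] ⟨(ω, x), x.2⟩).1 = (ϑ^[n] ω, (T.iter n ω x : X)) := by
  induction n generalizing ω with
  | zero => rfl
  | succ n ih => exact ih (ϑ ω) (T.map ω x)

theorem measurable_skew (T : BundleRDS X P ϑ) : Measurable T.skew :=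
  ((T.base_measurePreserving.measurable.comp
    (measurable_fst.comp measurable_subtype_coe)).prodMk T.measurable_map).subtype_mk

/-- The maximal number of visits to `E` before time `n` along an orbit that starts in `E_ω`:
`sup_{x ∈ E_ω} ∑_{i < n} 1_E (T^i_ω x)`. -/
noncomputable def maxVisits (T : BundleRDS X P ϑ) (E : Set X) (n : ℕ) (ω : Ω) : ℝ :=
  ⨆ x : T.fiber ω, ∑ i ∈ Finset.range n, E.indicator (fun _ => (1 : ℝ)) (T.iter i ω x : X)

/-- The `ω`-orbit capacity of `E` exists and equals `c`. -/
def HasOrbitCapacity (T : BundleRDS X P ϑ) (E : Set X) (ω : Ω) (c : ℝ) : Prop :=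
  Tendsto (fun n : ℕ => (1 / (n : ℝ)) * T.maxVisits E n ω) atTop (𝓝 c)

/-- `E` is `T`-small: its `ω`-orbit capacity is zero for `P`-almost every `ω`. -/
def IsSmall (T : BundleRDS X P ϑ) (E : Set X) : Prop :=
  ∀ᵐ ω ∂P, T.HasOrbitCapacity E ω 0

/-- The small boundary property. -/
def HasSBP (T : BundleRDS X P ϑ) : Prop :=
  ∀ (x : X) (U : Set X), IsOpen U → x ∈ U → ∃ V ∈ 𝓝 x, V ⊆ U ∧ T.IsSmall (frontier V)

/-- The `Θ`-invariant probability measures on `Ω × X` that have marginal `P` on `Ω` and are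
carried by the bundle. -/
def invariantMeasures (T : BundleRDS X P ϑ) : Set (Measure (Ω × X)) :=
  {μ | IsProbabilityMeasure μ ∧ μ.map Prod.fst = P ∧ μ T.graph = 1 ∧
    MeasurePreserving T.skew (μ.comap Subtype.val) (μ.comap Subtype.val)}

/-- `T` is uniquely ergodic: there is exactly one invariant measure over `P`. -/
def UniquelyErgodic (T : BundleRDS X P ϑ) : Prop :=
  ∃ μ, T.invariantMeasures = {μ}

end BundleRDS

/-! The core is `UniquelyErgodic.isSmall_of_isClosed`: a closed set `E` with `μ (Ω × E) = 0` is
small. Given `ε > 0`, choose a continuous `f` with `1_E ≤ f ≤ 1` and `∫ f dμ < ε`. Let `h_m` be the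
fibrewise supremum of the `m`-th Birkhoff sum of `f`. Its integrals are subadditive in `m`, so
`(1/m) ∫ h_m dP` converges to a sublinear functional of `f`, `maxAverage`.

By Hahn–Banach (`exists_invariant_functional`) some `Θ`-invariant linear functional dominated by `F
↦ ∫ sup F dP` attains this limit at `f`. It is represented by an invariant measure
(`exists_mem_invariantMeasures`), which can only be `μ`. Hence the limit is `∫ f dμ < ε`, and `∫ h_m
dP < m ε` for some `m`. Birkhoff's upper bound over the ergodic base, applied to `h_m`, together
with a comparison of sums over `n` steps with sums of blocks of length `m` (`mul_maxVisits_le`),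
bounds the visits to `E` by `n ε + O(1)` uniformly on almost every fibre.

Spheres about `x` are disjoint, so all but countably many are `μ`-null, hence small, and they
contain the boundaries of the balls.

Two technical points carry the length. Measurability of fibrewise suprema rests on the projection
theorem and the completeness of `P`. The functional lives on bounded measurable functions and need
not be countably additive there. It yields a bimeasure `(A, f) ↦ Λ (1_A f)`, which extends to a
measure and agrees with `Λ` on functions continuous on almost every fibre; this class contains `(1_A
f) ∘ Θ`, which gives invariance. -/

/-! ### Analytic sets and the measurable projection theorem. -/

/-- A finite Borel measure of an analytic set is approximated from inside by compact sets. -/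
theorem MeasureTheory.AnalyticSet.exists_isCompact_subset {α : Type*} [TopologicalSpace α]
    [MeasurableSpace α] (μ : Measure α) [IsFiniteMeasure μ] [μ.OuterRegular] {s : Set α}
    (hs : AnalyticSet s) {ε : ENNReal} (hε : ε ≠ 0) :
    ∃ K ⊆ s, IsCompact K ∧ μ s ≤ μ K + ε := by
  rw [AnalyticSet] at hs
  rcases hs with rfl | ⟨f, hf, rfl⟩
  · exact ⟨∅, subset_rfl, isCompact_empty, by simp⟩
  obtain ⟨δ, hδ, hδs⟩ := ENNReal.exists_pos_sum_of_countable' hε ℕ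
  -- The images need not be measurable: continuity from below along increasing sequences holds for
  -- arbitrary sets.
  have step : ∀ (C : Set (ℕ → ℕ)) (k : ℕ), ∃ N : ℕ,
      μ (f '' C) ≤ μ (f '' (C ∩ {x | x k ≤ N})) + δ k := by
    intro C k
    have hmono : Monotone fun N : ℕ => f '' (C ∩ {x | x k ≤ N}) := fun a b hab =>
      image_mono (inter_subset_inter_right _ fun x (hx : x k ≤ a) => hx.trans hab)
    have hU : (⋃ N : ℕ, f '' (C ∩ {x | x k ≤ N})) = f '' C := by
      rw [← image_iUnion, ← inter_iUnion]
      congr 1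
      exact inter_eq_left.2 fun x _ => mem_iUnion.2 ⟨x k, le_refl (x k)⟩
    have hsup := hmono.measure_iUnion (μ := μ)
    rw [hU] at hsup
    by_contra! hcon
    have hfin : μ (f '' C) ≠ ⊤ := measure_ne_top _ _
    have h1 : μ (f '' C) + δ k ≤ μ (f '' C) := by
      conv_lhs => rw [hsup]
      rw [ENNReal.iSup_add]
      exact iSup_le fun N => (hcon N).le
    exact absurd h1 (not_le.2 (ENNReal.lt_add_right hfin (hδ k).ne'))
  choose N hN using step
  let C : ℕ → Set (ℕ → ℕ) := fun k => Nat.rec univ (fun k C => C ∩ {x | x k ≤ N C k}) k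
  have hC0 : C 0 = univ := rfl
  have hCs : ∀ k, C (k + 1) = C k ∩ {x | x k ≤ N (C k) k} := fun k => rfl
  set n : ℕ → ℕ := fun k => N (C k) k with hn
  have hCmem : ∀ k x, x ∈ C k ↔ ∀ i < k, x i ≤ n i := by
    intro k x
    induction k with
    | zero => simp [hC0]
    | succ k ih => rw [hCs, mem_inter_iff, ih, Nat.forall_lt_succ_right]; rfl
  have hbound : ∀ k, μ (range f) ≤ μ (f '' C k) + ε := by
    intro k
    have : μ (range f) ≤ μ (f '' C k) + ∑ i ∈ Finset.range k, δ i := by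
      induction k with
      | zero => simp [hC0]
      | succ k ih =>
        rw [Finset.sum_range_succ]
        calc μ (range f) ≤ _ := ih
          _ ≤ μ (f '' C (k + 1)) + δ k + ∑ i ∈ Finset.range k, δ i := by
              gcongr; exact hN (C k) k
          _ = _ := by ring
    refine this.trans ?_
    gcongr
    exact (ENNReal.sum_le_tsum _).trans hδs.le
  let K : Set (ℕ → ℕ) := Set.pi univ fun i => Set.Iic (n i)
  have hK : IsCompact K := isCompact_univ_pi fun i => (Set.finite_Iic (n i)).isCompact
  refine ⟨f '' K, image_subset_range _ _, hK.image hf, ?_⟩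
  -- Continuity from above is not available for the sets `f '' C k`. Instead, every open set
  -- containing `f '' K` contains `f '' C k` for large `k`.
  rw [(f '' K).measure_eq_iInf_isOpen μ]
  simp only [ENNReal.iInf_add]
  refine le_iInf fun U => le_iInf fun hKU => le_iInf fun hU => ?_
  let : MetricSpace (ℕ → ℕ) := PiNat.metricSpaceNatNat
  obtain ⟨r, hr, hthick⟩ := hK.exists_thickening_subset_open (hU.preimage hf)
    (image_subset_iff.1 hKU)
  obtain ⟨k, hk⟩ := exists_pow_lt_of_lt_one hr (by norm_num : (1 / 2 : ℝ) < 1)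
  refine (hbound k).trans ?_
  gcongr
  rw [image_subset_iff]
  refine Subset.trans ?_ hthick
  intro x hx
  rw [hCmem] at hx
  -- Truncating `x` at `n` gives a point of `K` that agrees with `x` in the first `k` coordinates.
  refine Metric.mem_thickening_iff.2 ⟨fun i => min (x i) (n i), fun i _ => min_le_right (x i) (n i), ?_⟩
  refine lt_of_le_of_lt ?_ hk
  rw [← PiNat.mem_cylinder_iff_dist_le, PiNat.mem_cylinder_iff]
  intro i hi
  simp [hx i hi]

theorem MeasureTheory.AnalyticSet.nullMeasurableSet {α : Type*} [TopologicalSpace α] [T2Space α]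
    [MeasurableSpace α] [OpensMeasurableSpace α] (μ : Measure α) [IsFiniteMeasure μ]
    [μ.OuterRegular] {s : Set α} (hs : AnalyticSet s) : NullMeasurableSet s μ := by
  have h : ∀ n : ℕ, ∃ K ⊆ s, IsCompact K ∧ μ s ≤ μ K + (n + 1 : ENNReal)⁻¹ := fun n =>
    hs.exists_isCompact_subset μ (ENNReal.inv_ne_zero.2 (by finiteness))
  choose K hKs hK hμ using h
  have htm : MeasurableSet (⋃ n, K n) := MeasurableSet.iUnion fun n => (hK n).measurableSet
  have hts : (⋃ n, K n) ⊆ s := iUnion_subset hKs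
  have hle : μ s ≤ μ (⋃ n, K n) := by
    refine ENNReal.le_of_forall_pos_le_add fun ε hε _ => ?_
    obtain ⟨n, hn⟩ := ENNReal.exists_inv_nat_lt (ENNReal.coe_pos.2 hε).ne'
    refine (hμ n).trans (add_le_add (measure_mono (subset_iUnion K n)) ?_)
    exact (ENNReal.inv_le_inv.2 le_self_add).trans hn.le
  have hdiff : μ (s \ ⋃ n, K n) = 0 := by
    rw [measure_sdiff hts htm.nullMeasurableSet (measure_ne_top _ _)]
    exact tsub_eq_zero_of_le hle
  rw [← union_sdiff_cancel hts]
  exact htm.nullMeasurableSet.union (NullMeasurableSet.of_null hdiff)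

/-- A measurable subset of a product depends on its first coordinate through a map to the
Cantor space. -/
theorem MeasurableSet.exists_eq_preimage_prodMap_id {Ω X : Type*} [MeasurableSpace Ω]
    [MeasurableSpace X] {S : Set (Ω × X)} (hS : MeasurableSet S) :
    ∃ (φ : Ω → ℕ → Bool) (S' : Set ((ℕ → Bool) × X)), Measurable φ ∧ MeasurableSet S' ∧
      S = Prod.map φ id ⁻¹' S' := by
  classical
  rw [← generateFrom_prod] at hS
  induction S, hS using MeasurableSpace.generateFrom_induction with
  | hC t ht _ =>
    obtain ⟨A, hA, B, hB, rfl⟩ := ht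
    refine ⟨fun ω _ => decide (ω ∈ A), {z : ℕ → Bool | z 0 = true} ×ˢ B, ?_, ?_, ?_⟩
    · exact measurable_pi_lambda _ fun _ => measurable_to_bool (by simpa [preimage] using hA)
    · exact (measurableSet_eq_fun (measurable_pi_apply 0) measurable_const).prod hB
    · ext ⟨ω, x⟩; simp
  | empty => exact ⟨fun _ _ => true, ∅, measurable_const, .empty, by simp⟩
  | compl t _ ih =>
    obtain ⟨φ, S', hφ, hS', rfl⟩ := ih
    exact ⟨φ, S'ᶜ, hφ, hS'.compl, rfl⟩
  | iUnion s _ ih =>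
    choose φ S' hφ hS' h using ih
    -- Countably many codes are interleaved into one by the pairing function.
    refine ⟨fun ω k => φ k.unpair.1 ω k.unpair.2,
      ⋃ n, (fun p : (ℕ → Bool) × X => ((fun k => p.1 (Nat.pair n k)), p.2)) ⁻¹' S' n,
      measurable_pi_lambda _ fun k => (measurable_pi_apply _).comp (hφ _),
      MeasurableSet.iUnion fun n => ?_, ?_⟩
    · refine Measurable.prodMk (measurable_pi_lambda _ fun k => ?_) measurable_snd (hS' n)
      exact (measurable_pi_apply _).comp measurable_fst
    · rw [preimage_iUnion]
      refine iUnion_congr fun n => (h n).trans ?_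
      ext ⟨ω, x⟩
      simp

/-- **Measurable projection theorem**, for a complete finite measure and a Polish fibre. -/
theorem MeasurableSet.image_fst_of_isComplete {Ω X : Type*} [MeasurableSpace Ω]
    (P : Measure Ω) [IsFiniteMeasure P] [P.IsComplete] [TopologicalSpace X] [PolishSpace X]
    [MeasurableSpace X] [BorelSpace X] {S : Set (Ω × X)} (hS : MeasurableSet S) :
    MeasurableSet (Prod.fst '' S) := by
  obtain ⟨φ, S', hφ, hS', rfl⟩ := hS.exists_eq_preimage_prodMap_id
  have h : Prod.fst '' (Prod.map φ id ⁻¹' S') = φ ⁻¹' (Prod.fst '' S') := by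
    ext ω
    simp
  have : PolishSpace ((ℕ → Bool) × X) := { }
  -- Over the Cantor space the projection is analytic, hence null measurable for the image measure;
  -- completeness of `P` makes its preimage measurable.
  have hn : NullMeasurableSet (Prod.fst '' S') (P.map φ) :=
    (hS'.analyticSet.image_of_continuous continuous_fst).nullMeasurableSet _
  rw [h]
  exact (hn.preimage ⟨hφ, Measure.AbsolutelyContinuous.rfl⟩).measurable_of_complete

/-! ### Birkhoff's upper bound through the maximal ergodic argument. -/

theorem MeasureTheory.MeasurePreserving.integral_comp_of_aestronglyMeasurable {α β : Type*}
    [MeasurableSpace α] [MeasurableSpace β] {μ : Measure α} {ν : Measure β} {θ : α → β}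
    (hθ : MeasurePreserving θ μ ν) {f : β → ℝ} (hf : AEStronglyMeasurable f ν) :
    ∫ x, f (θ x) ∂μ = ∫ y, f y ∂ν := by
  rw [← hθ.map_eq] at hf ⊢
  exact (integral_map hθ.measurable.aemeasurable hf).symm

/-- The maximum of `0` and of the first `n` Birkhoff sums. -/
noncomputable def birkhoffMax {α : Type*} (θ : α → α) (h : α → ℝ) : ℕ → α → ℝ
  | 0, _ => 0
  | n + 1, x => max 0 (h x + birkhoffMax θ h n (θ x))

theorem birkhoffMax_nonneg {α : Type*} (θ : α → α) (h : α → ℝ) (n : ℕ) (x : α) :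
    0 ≤ birkhoffMax θ h n x := by
  cases n <;> simp [birkhoffMax]

theorem birkhoffMax_le_succ {α : Type*} (θ : α → α) (h : α → ℝ) (n : ℕ) (x : α) :
    birkhoffMax θ h n x ≤ birkhoffMax θ h (n + 1) x := by
  induction n generalizing x with
  | zero => exact birkhoffMax_nonneg θ h 1 x
  | succ n ih => exact max_le_max le_rfl (by gcongr; exact ih _)

theorem birkhoffSum_le_birkhoffMax {α : Type*} (θ : α → α) (h : α → ℝ) (n : ℕ) (x : α) :
    birkhoffSum θ h n x ≤ birkhoffMax θ h n x := by
  induction n generalizing x with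
  | zero => simp [birkhoffMax]
  | succ n ih =>
    rw [birkhoffSum_succ']
    exact le_max_of_le_right (by gcongr; exact ih _)

theorem measurable_birkhoffMax {α : Type*} [MeasurableSpace α] {θ : α → α} (hθ : Measurable θ)
    {h : α → ℝ} (hh : Measurable h) (n : ℕ) : Measurable (birkhoffMax θ h n) := by
  induction n with
  | zero => exact measurable_const
  | succ n ih => exact measurable_const.max (hh.add (ih.comp hθ))

theorem birkhoffMax_le {α : Type*} (θ : α → α) {h : α → ℝ} {C : ℝ} (hC : ∀ x, |h x| ≤ C)
    (n : ℕ) (x : α) : birkhoffMax θ h n x ≤ n * C := by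
  have hC0 : 0 ≤ C := (abs_nonneg _).trans (hC x)
  induction n generalizing x with
  | zero => simp [birkhoffMax]
  | succ n ih =>
    push_cast
    refine max_le (by positivity) ?_
    linarith [ih (θ x), (abs_le.1 (hC x)).2]

/-- If the Birkhoff sums of a bounded function are almost surely unbounded above, then the function
has nonnegative integral. -/
theorem integral_nonneg_of_ae_not_bddAbove_birkhoffMax {α : Type*} [MeasurableSpace α]
    {μ : Measure α} [IsProbabilityMeasure μ] {θ : α → α} (hθ : MeasurePreserving θ μ μ)
    {h : α → ℝ} (hh : Measurable h) {C : ℝ} (hC : ∀ x, |h x| ≤ C)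
    (hub : ∀ᵐ x ∂μ, ¬ BddAbove (range fun n => birkhoffMax θ h n x)) : 0 ≤ ∫ x, h x ∂μ := by
  have hint : ∀ n, Integrable (birkhoffMax θ h n) μ := fun n =>
    Integrable.of_bound (measurable_birkhoffMax hθ.measurable hh n).aestronglyMeasurable (n * C)
      (ae_of_all _ fun x => by
        rw [Real.norm_of_nonneg (birkhoffMax_nonneg ..)]; exact birkhoffMax_le θ hC n x)
  have hub' : ∀ᵐ x ∂μ, ¬ BddAbove (range fun n => birkhoffMax θ h n (θ x)) :=
    hθ.quasiMeasurePreserving.ae hub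
  -- This difference tends to `h` wherever the maxima along `θ x` tend to infinity. By invariance of
  -- `μ` its integral is that of an increment of the maxima, hence nonnegative.
  have heq : ∀ n x, birkhoffMax θ h (n + 1) x - birkhoffMax θ h n (θ x) =
      max (-birkhoffMax θ h n (θ x)) (h x) := fun n x => by
    simp only [birkhoffMax]
    rw [← max_sub_sub_right, zero_sub, add_sub_cancel_right]
  have hlim : Tendsto (fun n => ∫ x, max (-birkhoffMax θ h n (θ x)) (h x) ∂μ) atTop
      (𝓝 (∫ x, h x ∂μ)) := by
    refine tendsto_integral_of_dominated_convergence (fun _ => C) (fun n => ?_)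
      (integrable_const _) (fun n => ae_of_all _ fun x => ?_) ?_
    · exact (((measurable_birkhoffMax hθ.measurable hh n).comp hθ.measurable).neg.max
        hh).aestronglyMeasurable
    · have h0 := birkhoffMax_nonneg θ h n (θ x)
      have h1 := abs_le.1 (hC x)
      exact abs_le.2 ⟨h1.1.trans (le_max_right _ _), max_le (by linarith) h1.2⟩
    · filter_upwards [hub'] with x hx
      have htop := tendsto_atTop_atTop_of_monotone'
        (monotone_nat_of_le_succ fun n => birkhoffMax_le_succ θ h n (θ x)) hx
      refine tendsto_const_nhds.congr' ?_
      filter_upwards [htop.eventually_ge_atTop (-h x)] with n hn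
      rw [max_eq_right (by linarith)]
  refine ge_of_tendsto' hlim fun n => ?_
  have hcomp : ∫ x, birkhoffMax θ h n (θ x) ∂μ = ∫ x, birkhoffMax θ h n x ∂μ :=
    hθ.integral_comp_of_aestronglyMeasurable (hint n).aestronglyMeasurable
  simp_rw [← heq]
  have hint' : Integrable (fun x => birkhoffMax θ h n (θ x)) μ :=
    hθ.integrable_comp_of_integrable (hint n)
  rw [integral_sub (hint _) hint', hcomp, sub_nonneg]
  exact integral_mono (hint _) (hint _) (birkhoffMax_le_succ θ h n)

/-- The recursion moves bounds between `x` and `θ x`. The event is thus strictly invariant, and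
ergodicity gives it measure zero or one. -/
theorem bddAbove_range_birkhoffMax_comp_iff {α : Type*} (θ : α → α) (h : α → ℝ) (x : α) :
    BddAbove (range fun n => birkhoffMax θ h n (θ x)) ↔
      BddAbove (range fun n => birkhoffMax θ h n x) := by
  constructor
  · rintro ⟨M, hM⟩
    refine ⟨max 0 (h x + M), ?_⟩
    rintro _ ⟨n, rfl⟩
    refine (birkhoffMax_le_succ θ h n x).trans (max_le_max le_rfl ?_)
    gcongr
    exact hM ⟨n, rfl⟩
  · rintro ⟨M, hM⟩
    refine ⟨M - h x, ?_⟩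
    rintro _ ⟨n, rfl⟩
    have h1 : birkhoffMax θ h (n + 1) x ≤ M := hM ⟨n + 1, rfl⟩
    have h2 : h x + birkhoffMax θ h n (θ x) ≤ birkhoffMax θ h (n + 1) x := le_max_right _ _
    change birkhoffMax θ h n (θ x) ≤ M - h x
    linarith

/-- The upper bound in **Birkhoff's ergodic theorem**, for an ergodic transformation and a bounded
function. -/
theorem Ergodic.ae_eventually_birkhoffSum_le {α : Type*} [MeasurableSpace α]
    {μ : Measure α} [IsProbabilityMeasure μ] {θ : α → α} (hθ : Ergodic θ μ)
    {h : α → ℝ} (hh : Measurable h) {C : ℝ} (hC : ∀ x, |h x| ≤ C) {c : ℝ}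
    (hc : ∫ x, h x ∂μ < c) : ∀ᵐ x ∂μ, ∃ M, ∀ n : ℕ, birkhoffSum θ h n x ≤ M + n * c := by
  set k : α → ℝ := fun x => h x - c with hk
  have hkm : Measurable k := hh.sub_const c
  have hkC : ∀ x, |k x| ≤ C + |c| := fun x =>
    (abs_sub _ _).trans (by gcongr; exact hC x)
  have hmeas : MeasurableSet {x | BddAbove (range fun n => birkhoffMax θ k n x)} :=
    measurableSet_bddAbove_range fun n => measurable_birkhoffMax hθ.measurable hkm n
  have hinv : θ ⁻¹' {x | BddAbove (range fun n => birkhoffMax θ k n x)} =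
      {x | BddAbove (range fun n => birkhoffMax θ k n x)} := by
    ext x
    exact bddAbove_range_birkhoffMax_comp_iff θ k x
  have hsum : ∀ n x, birkhoffSum θ k n x = birkhoffSum θ h n x - n * c := fun n x => by
    simp [birkhoffSum, hk, Finset.sum_sub_distrib]
  have hae : ∀ᵐ x ∂μ, BddAbove (range fun n => birkhoffMax θ k n x) := by
    rcases hθ.toPreErgodic.prob_eq_zero_or_one hmeas hinv with h0 | h1
    -- Almost sure unboundedness would force `∫ (h - c) ≥ 0`, against `hc`.
    · have := integral_nonneg_of_ae_not_bddAbove_birkhoffMax hθ.toMeasurePreserving hkm hkC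
        (measure_eq_zero_iff_ae_notMem.1 h0)
      have hhi : Integrable h μ := Integrable.of_bound hh.aestronglyMeasurable C (ae_of_all _ hC)
      rw [integral_sub hhi (integrable_const c)] at this
      simp at this
      linarith
    · exact (mem_ae_iff_prob_eq_one hmeas).2 h1
  filter_upwards [hae] with x hx
  obtain ⟨M, hM⟩ := hx
  refine ⟨M, fun n => ?_⟩
  have h1 : birkhoffMax θ k n x ≤ M := hM ⟨n, rfl⟩
  linarith [hsum n x, birkhoffSum_le_birkhoffMax θ k n x]

/-! ### Extension of bimeasures to measures on the product. -/

/-- Almost everywhere, functions whose set integrals are increasing are the values of a rational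
distribution function, if their total integrals are the values of a distribution function. -/
theorem ProbabilityTheory.ae_isRatStieltjesPoint {Ω : Type*} [MeasurableSpace Ω] {P : Measure Ω}
    [IsProbabilityMeasure P] (τ : Measure ℝ) [IsProbabilityMeasure τ] {h : Ω → ℚ → ℝ}
    (hint : ∀ q, Integrable (fun ω => h ω q) P) (h0 : ∀ ω q, 0 ≤ h ω q)
    (hmono : ∀ q r, q ≤ r → ∀ A, MeasurableSet A → ∫ ω in A, h ω q ∂P ≤ ∫ ω in A, h ω r ∂P)
    (hle : ∀ q A, MeasurableSet A → ∫ ω in A, h ω q ∂P ≤ P.real A)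
    (hτ : ∀ q : ℚ, ∫ ω, h ω q ∂P = cdf τ q) :
    ∀ᵐ ω ∂P, IsRatStieltjesPoint h ω := by
  have hm : ∀ᵐ ω ∂P, ∀ q r, q ≤ r → h ω q ≤ h ω r := by
    simp only [ae_all_iff]
    exact fun q r hqr => ae_le_of_forall_setIntegral_le (hint q) (hint r)
      fun A hA _ => hmono q r hqr A hA
  have h1 : ∀ᵐ ω ∂P, ∀ q, h ω q ≤ 1 := by
    simp only [ae_all_iff]
    exact fun q => ae_le_of_forall_setIntegral_le (hint q) (integrable_const 1)
      fun A hA _ => by simpa using hle q A hA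
  -- A monotone sequence bounded by a function converges to it almost everywhere as soon as the
  -- integrals do. The limit at `-∞` and right continuity follow in the same way.
  have htop : ∀ᵐ ω ∂P, Tendsto (fun n : ℕ => h ω n) atTop (𝓝 1) := by
    refine tendsto_of_integral_tendsto_of_monotone (fun n => hint n) (integrable_const 1) ?_ ?_ ?_
    · simp only [hτ]
      simpa [Function.comp_def] using (tendsto_cdf_atTop τ).comp tendsto_natCast_atTop_atTop
    · filter_upwards [hm] with ω hω a b hab
      exact hω _ _ (by exact_mod_cast hab)
    · filter_upwards [h1] with ω hω n using hω n
  have hbot : ∀ᵐ ω ∂P, Tendsto (fun n : ℕ => h ω (-n)) atTop (𝓝 0) := by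
    refine tendsto_of_integral_tendsto_of_antitone (fun n => hint (-n)) (integrable_zero _ _ _)
      ?_ ?_ ?_
    · simp only [hτ]
      simpa [Function.comp_def] using (tendsto_cdf_atBot τ).comp
        (tendsto_neg_atTop_atBot.comp tendsto_natCast_atTop_atTop)
    · filter_upwards [hm] with ω hω a b hab
      exact hω _ _ (by simpa using hab)
    · exact ae_of_all _ fun ω n => h0 ω _
  have hright : ∀ᵐ ω ∂P, ∀ t : ℚ,
      Tendsto (fun n : ℕ => h ω (t + 1 / (n + 1))) atTop (𝓝 (h ω t)) := by
    rw [ae_all_iff]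
    intro t
    refine tendsto_of_integral_tendsto_of_antitone (fun n => hint _) (hint t) ?_ ?_ ?_
    · simp only [hτ]
      refine ((cdf τ).right_continuous (t : ℝ)).tendsto.comp ?_
      refine tendsto_nhdsWithin_iff.2 ⟨?_, Eventually.of_forall fun n => ?_⟩
      · simpa using (tendsto_one_div_add_atTop_nhds_zero_nat (𝕜 := ℝ)).const_add (t : ℝ)
      · have hn : (0 : ℝ) ≤ 1 / ((n : ℝ) + 1) := by positivity
        push_cast
        exact le_add_of_nonneg_right hn
    · filter_upwards [hm] with ω hω a b hab
      refine hω _ _ ?_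
      gcongr
    · filter_upwards [hm] with ω hω n
      have hn : (0 : ℚ) ≤ 1 / ((n : ℚ) + 1) := by positivity
      exact hω t _ (le_add_of_nonneg_right hn)
  filter_upwards [hm, h1, htop, hbot, hright] with ω hm h1 htop hbot hright
  have hmon : Monotone (h ω) := fun q r => hm q r
  refine ⟨hmon, ?_, ?_, fun t => ?_⟩
  · exact (tendsto_iff_tendsto_subseq_of_monotone hmon tendsto_natCast_atTop_atTop).2 htop
  · have hanti : Antitone fun q : ℚ => h ω (-q) := fun a b hab => hmon (neg_le_neg hab)
    have := (tendsto_iff_tendsto_subseq_of_antitone hanti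
      (tendsto_natCast_atTop_atTop (R := ℚ))).2 hbot
    simpa [Function.comp_def] using this.comp tendsto_neg_atBot_atTop
  · have hbdd : BddBelow (range fun r : Ioi t => h ω r) := ⟨0, by rintro _ ⟨r, rfl⟩; exact h0 _ _⟩
    refine le_antisymm ?_ (le_ciInf fun r => hmon r.2.le)
    refine ge_of_tendsto' (hright t) fun n => ?_
    have hn : t < t + 1 / ((n : ℚ) + 1) := lt_add_of_pos_right t (by positivity)
    exact ciInf_le hbdd ⟨_, hn⟩

section Bimeasure

variable {Ω X : Type*} [MeasurableSpace Ω] [MeasurableSpace X] {P : Measure Ω}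
  [IsProbabilityMeasure P]

/-- A family of measures that is countably additive in a set parameter `A`, with masses `P A`, has
densities with respect to `P`. -/
theorem exists_density_of_sum_eq (ν : ∀ A : Set Ω, MeasurableSet A → Measure X)
    (hνu : ∀ A hA, ν A hA univ = P A)
    (hν : ∀ (A : ℕ → Set Ω) (hA : ∀ n, MeasurableSet (A n)), Pairwise (Function.onFun Disjoint A) →
      ν (⋃ n, A n) (.iUnion hA) = Measure.sum fun n => ν (A n) (hA n))
    {B : Set X} (hB : MeasurableSet B) :
    ∃ h : Ω → ℝ, Measurable h ∧ Integrable h P ∧ (∀ ω, 0 ≤ h ω) ∧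
      ∀ A (hA : MeasurableSet A), ∫ ω in A, h ω ∂P = (ν A hA).real B := by
  let ρ : Measure Ω := Measure.ofMeasurable (fun A hA => ν A hA B)
    (by
      have h0 := hνu ∅ .empty
      rw [measure_empty] at h0
      exact measure_mono_null (subset_univ _) h0)
    (fun A hA hd => by simp only [hν A hA hd, Measure.sum_apply _ hB])
  have hρ : ∀ A (hA : MeasurableSet A), ρ A = ν A hA B := fun A hA =>
    Measure.ofMeasurable_apply A hA
  have hρP : ρ ≤ P := Measure.le_iff.2 fun A hA => by
    rw [hρ A hA, ← hνu A hA]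
    exact measure_mono (subset_univ _)
  have : IsFiniteMeasure ρ := isFiniteMeasure_of_le P hρP
  refine ⟨fun ω => (ρ.rnDeriv P ω).toReal, (Measure.measurable_rnDeriv _ _).ennreal_toReal,
    Measure.integrable_toReal_rnDeriv, fun _ => ENNReal.toReal_nonneg, fun A hA => ?_⟩
  rw [Measure.setIntegral_toReal_rnDeriv (Measure.absolutelyContinuous_of_le hρP), measureReal_def,
    hρ A hA, measureReal_def]

/-- A bimeasure on `Ω × X` with first marginal `P` extends to a measure, if `X` is a standard Borel
space. -/
theorem exists_measure_prod_eq_of_sum_eq [StandardBorelSpace X]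
    (ν : ∀ A : Set Ω, MeasurableSet A → Measure X)
    (hνu : ∀ A hA, ν A hA univ = P A)
    (hν : ∀ (A : ℕ → Set Ω) (hA : ∀ n, MeasurableSet (A n)), Pairwise (Function.onFun Disjoint A) →
      ν (⋃ n, A n) (.iUnion hA) = Measure.sum fun n => ν (A n) (hA n)) :
    ∃ m : Measure (Ω × X), ∀ A hA B, MeasurableSet B → m (A ×ˢ B) = ν A hA B := by
  have hνfin : ∀ A hA, IsFiniteMeasure (ν A hA) := fun A hA =>
    ⟨by rw [hνu]; exact measure_lt_top P A⟩
  let e : X → ℝ := embeddingReal X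
  have he : MeasurableEmbedding e := measurableEmbedding_embeddingReal X
  have hB : ∀ q : ℚ, MeasurableSet (e ⁻¹' Iic (q : ℝ)) := fun q => he.measurable measurableSet_Iic
  -- After embedding `X` in `ℝ`, these densities are the values at rationals of a conditional
  -- distribution function, from which the kernel `κ` is built.
  choose h hmeas hint h0 hset using fun q : ℚ => exists_density_of_sum_eq ν hνu hν (hB q)
  have : IsProbabilityMeasure (ν univ .univ) := ⟨by rw [hνu, measure_univ]⟩
  have : IsProbabilityMeasure ((ν univ .univ).map e) :=
    Measure.isProbabilityMeasure_map he.measurable.aemeasurable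
  have hst : ∀ᵐ ω ∂P, ProbabilityTheory.IsRatStieltjesPoint (fun ω q => h q ω) ω := by
    refine ProbabilityTheory.ae_isRatStieltjesPoint ((ν univ .univ).map e) hint
      (fun ω q => h0 q ω) (fun q r hqr A hA => ?_) (fun q A hA => ?_) fun q => ?_
    · rw [hset q A hA, hset r A hA]
      exact measureReal_mono (preimage_mono (Iic_subset_Iic.2 (by exact_mod_cast hqr)))
    · rw [hset q A hA, measureReal_def, measureReal_def, ← hνu A hA]
      exact ENNReal.toReal_mono (measure_ne_top _ _) (measure_mono (subset_univ _))
    · rw [ProbabilityTheory.cdf_eq_real, map_measureReal_apply he.measurable measurableSet_Iic,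
        ← hset q univ .univ, Measure.restrict_univ]
  have hm : Measurable fun ω q => h q ω := measurable_pi_lambda _ hmeas
  let κ : ProbabilityTheory.Kernel Ω ℝ :=
    ⟨fun ω => (ProbabilityTheory.stieltjesOfMeasurableRat _ hm ω).measure,
      ProbabilityTheory.measurable_measure_stieltjesOfMeasurableRat hm⟩
  have : ProbabilityTheory.IsMarkovKernel κ := ⟨fun ω =>
    ProbabilityTheory.instIsProbabilityMeasure_stieltjesOfMeasurableRat hm ω⟩
  have hIic : ∀ A (hA : MeasurableSet A) (q : ℚ),
      (P.compProd κ) (A ×ˢ Iic (q : ℝ)) = ν A hA (e ⁻¹' Iic (q : ℝ)) := by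
    intro A hA q
    rw [Measure.compProd_apply_prod hA measurableSet_Iic]
    have : ∫⁻ ω in A, κ ω (Iic (q : ℝ)) ∂P = ∫⁻ ω in A, ENNReal.ofReal (h q ω) ∂P := by
      refine lintegral_congr_ae (ae_restrict_of_ae ?_)
      filter_upwards [hst] with ω hω
      change (ProbabilityTheory.stieltjesOfMeasurableRat _ hm ω).measure (Iic (q : ℝ)) = _
      rw [ProbabilityTheory.measure_stieltjesOfMeasurableRat_Iic,
        ProbabilityTheory.stieltjesOfMeasurableRat_eq,
        ProbabilityTheory.toRatCDF_of_isRatStieltjesPoint hω]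
    rw [this, ← ofReal_integral_eq_lintegral_ofReal (hint q).integrableOn (ae_of_all _ (h0 q)),
      hset q A hA, ofReal_measureReal]
  have hmap : ∀ A (hA : MeasurableSet A),
      ((P.compProd κ).restrict (A ×ˢ univ)).map Prod.snd = (ν A hA).map e := by
    intro A hA
    have hq : ∀ q : ℚ, ((P.compProd κ).restrict (A ×ˢ univ)).map Prod.snd (Iic (q : ℝ)) =
        (ν A hA).map e (Iic (q : ℝ)) := fun q => by
      rw [he.map_apply, ← hIic A hA q, Measure.map_apply measurable_snd measurableSet_Iic,
        Measure.restrict_apply (measurable_snd measurableSet_Iic)]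
      congr 1
      ext ⟨ω, x⟩
      simp [and_comm]
    refine ext_of_generate_finite _ (BorelSpace.measurable_eq.trans
      Real.borel_eq_generateFrom_Iic_rat) Real.isPiSystem_Iic_rat ?_ ?_
    · simp only [mem_iUnion, mem_singleton_iff]
      rintro _ ⟨q, rfl⟩
      exact hq q
    · rw [Measure.map_apply measurable_snd .univ, preimage_univ,
        Measure.restrict_apply_univ, Measure.compProd_apply_prod hA .univ,
        Measure.map_apply he.measurable .univ, preimage_univ, hνu]
      simp
  refine ⟨(P.compProd κ).comap (Prod.map id e), fun A hA B hB' => ?_⟩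
  rw [(MeasurableEmbedding.id.prodMap he).comap_apply, prodMap_image_prod, image_id]
  have h2 := congrArg (fun m => m (e '' B)) (hmap A hA)
  rw [he.map_apply, preimage_image_eq _ he.injective,
    Measure.map_apply measurable_snd (he.measurableSet_image.2 hB'),
    Measure.restrict_apply (measurable_snd (he.measurableSet_image.2 hB'))] at h2
  rw [← h2]
  congr 1
  ext ⟨ω, x⟩
  simp [and_comm]

end Bimeasure

/-! ### Measures from families of positive functionals on `C(X, ℝ)`. -/

/-- The **Riesz-Markov-Kakutani theorem** on a compact metric space, for a positive functional on
the space of all continuous functions. -/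
theorem ContinuousMap.exists_measure_integral_eq {X : Type*} [MetricSpace X] [CompactSpace X]
    [MeasurableSpace X] [BorelSpace X] (Λ : C(X, ℝ) →ₗ[ℝ] ℝ) (hΛ : ∀ f, 0 ≤ f → 0 ≤ Λ f) :
    ∃ ν : Measure X, IsFiniteMeasure ν ∧ ∀ f : C(X, ℝ), ∫ x, f x ∂ν = Λ f := by
  let Λ' : CompactlySupportedContinuousMap X ℝ →ₚ[ℝ] ℝ := PositiveLinearMap.mk₀
    { toFun := fun f => Λ f.toContinuousMap
      map_add' := fun f g => Λ.map_add _ _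
      map_smul' := fun c f => Λ.map_smul _ _ } fun f hf => hΛ _ hf
  refine ⟨RealRMK.rieszMeasure Λ', inferInstance, fun f => ?_⟩
  exact RealRMK.integral_rieszMeasure Λ' (CompactlySupportedContinuousMap.continuousMapEquiv f)

/-- Positive functionals `f ↦ L A f` on `C(X, ℝ)` that depend additively on a measurable set `A`
and have masses `P A` are represented by a measure on the product. -/
theorem exists_measure_setIntegral_eq {Ω X : Type*} [MeasurableSpace Ω] (P : Measure Ω)
    [IsProbabilityMeasure P] [MetricSpace X] [CompactSpace X] [MeasurableSpace X] [BorelSpace X]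
    (L : ∀ A : Set Ω, MeasurableSet A → C(X, ℝ) →ₗ[ℝ] ℝ)
    (hL : ∀ A hA f, 0 ≤ f → 0 ≤ L A hA f) (hL1 : ∀ A hA, L A hA 1 = P.real A)
    (hLadd : ∀ A hA B hB f, Disjoint A B →
      L (A ∪ B) (MeasurableSet.union hA hB) f = L A hA f + L B hB f) :
    ∃ m : Measure (Ω × X), IsProbabilityMeasure m ∧ m.map Prod.fst = P ∧
      ∀ A hA (f : C(X, ℝ)), ∫ p in A ×ˢ univ, f p.2 ∂m = L A hA f := by
  choose ν hfin hν using fun A hA =>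
    ContinuousMap.exists_measure_integral_eq (L A hA) (hL A hA)
  have hνu : ∀ A hA, ν A hA univ = P A := fun A hA => by
    have h1 := hν A hA 1
    rw [hL1] at h1
    simp only [ContinuousMap.one_apply, integral_const, smul_eq_mul, mul_one] at h1
    rw [← ofReal_measureReal (μ := ν A hA), h1, ofReal_measureReal]
  have hext : ∀ (μ₁ μ₂ : Measure X) [IsFiniteMeasure μ₁] [IsFiniteMeasure μ₂],
      (∀ f : C(X, ℝ), ∫ x, f x ∂μ₁ = ∫ x, f x ∂μ₂) → μ₁ = μ₂ := fun μ₁ μ₂ _ _ h =>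
    ext_of_forall_integral_eq_of_IsFiniteMeasure fun f => h f.toContinuousMap
  have hint : ∀ (μ : Measure X) [IsFiniteMeasure μ] (f : C(X, ℝ)), Integrable (fun x => f x) μ :=
    fun μ _ f => f.continuous.integrable_of_hasCompactSupport (HasCompactSupport.of_compactSpace _)
  have hadd : ∀ A hA B hB, Disjoint A B →
      ν (A ∪ B) (MeasurableSet.union hA hB) = ν A hA + ν B hB := fun A hA B hB hd =>
    hext _ _ fun f => by
      rw [integral_add_measure (hint _ f) (hint _ f), hν, hν, hν, hLadd A hA B hB f hd]
  have hcongr : ∀ A B hA hB, A = B → ν A hA = ν B hB := by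
    rintro A _ hA hB rfl
    rfl
  have hsum : ∀ (A : ℕ → Set Ω) (hA : ∀ n, MeasurableSet (A n)),
      Pairwise (Function.onFun Disjoint A) →
      ν (⋃ n, A n) (.iUnion hA) = Measure.sum fun n => ν (A n) (hA n) := by
    intro A hA hd
    have hfinset : ∀ s : Finset ℕ, ν (⋃ n ∈ s, A n) (s.measurableSet_biUnion fun n _ => hA n) =
        ∑ n ∈ s, ν (A n) (hA n) := by
      intro s
      induction s using Finset.induction_on with
      | empty =>
        rw [Finset.sum_empty, ← Measure.measure_univ_eq_zero, hνu]
        simp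
      | insert a s ha ih =>
        rw [Finset.sum_insert ha, ← ih, ← hadd]
        · exact hcongr _ _ _ _ (Finset.set_biUnion_insert a s A)
        · exact disjoint_iUnion₂_right.2 fun n hn => hd (ne_of_mem_of_not_mem hn ha).symm
    -- Finite additivity yields only this inequality; it is an equality because both sides have
    -- total mass `P (⋃ n, A n)`.
    have hle : Measure.sum (fun n => ν (A n) (hA n)) ≤ ν (⋃ n, A n) (.iUnion hA) := by
      refine Measure.le_iff.2 fun S hS => ?_
      rw [Measure.sum_apply _ hS, ENNReal.tsum_eq_iSup_sum]
      refine iSup_le fun s => ?_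
      have hsub : (⋃ n ∈ s, A n) ⊆ ⋃ n, A n := iUnion₂_subset fun n _ => subset_iUnion A n
      have hms : MeasurableSet (⋃ n ∈ s, A n) := s.measurableSet_biUnion fun n _ => hA n
      have hmd := (MeasurableSet.iUnion hA).diff hms
      rw [← Measure.finsetSum_apply, ← hfinset, ← hcongr _ _ (hms.union hmd) (.iUnion hA)
        (union_sdiff_cancel hsub), hadd _ hms _ hmd disjoint_sdiff_right]
      exact le_self_add
    have := isFiniteMeasure_of_le _ hle
    refine (Measure.eq_of_le_of_measure_univ_eq hle ?_).symm
    rw [Measure.sum_apply _ .univ, hνu, measure_iUnion hd hA]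
    simp only [hνu]
  obtain ⟨m, hm⟩ := exists_measure_prod_eq_of_sum_eq ν hνu hsum
  have hfst : m.map Prod.fst = P := Measure.ext fun A hA => by
    rw [Measure.map_apply measurable_fst hA, ← prod_univ, hm A hA univ .univ, hνu]
  refine ⟨m, ⟨?_⟩, hfst, fun A hA f => ?_⟩
  · rw [← univ_prod_univ, hm univ .univ univ .univ, hνu, measure_univ]
  · have hmap : (m.restrict (A ×ˢ univ)).map Prod.snd = ν A hA := Measure.ext fun B hB => by
      rw [Measure.map_apply measurable_snd hB, Measure.restrict_apply (measurable_snd hB),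
        ← hm A hA B hB]
      congr 1
      ext ⟨ω, x⟩
      simp [and_comm]
    rw [← hν A hA f, ← hmap, integral_map measurable_snd.aemeasurable
      f.continuous.measurable.aestronglyMeasurable]

/-! ### Fibrewise suprema and the asymptotic maximal average. -/

namespace BundleRDS

section Functional

variable {Ω : Type*} [MeasurableSpace Ω] {X : Type*} [TopologicalSpace X] [MeasurableSpace X]
  {P : Measure Ω} {ϑ : Ω → Ω}

/-- The supremum over each fibre of a function on the bundle. -/
noncomputable def fiberSup (T : BundleRDS X P ϑ) (F : T.graph → ℝ) (ω : Ω) : ℝ :=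
  ⨆ x : T.fiber ω, F ⟨(ω, x), x.2⟩

/-- The space of bounded measurable functions on the bundle. -/
def boundedMeasurable (T : BundleRDS X P ϑ) : Submodule ℝ (T.graph → ℝ) where
  carrier := {F | Measurable F ∧ ∃ C, ∀ p, |F p| ≤ C}
  zero_mem' := ⟨measurable_const, 0, fun p => by simp⟩
  add_mem' := by
    rintro F G ⟨hF, C, hC⟩ ⟨hG, D, hD⟩
    exact ⟨hF.add hG, C + D, fun p => (abs_add_le _ _).trans (add_le_add (hC p) (hD p))⟩
  smul_mem' := by
    rintro c F ⟨hF, C, hC⟩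
    refine ⟨hF.const_smul c, |c| * C, fun p => ?_⟩
    rw [Pi.smul_apply, smul_eq_mul, abs_mul]
    exact mul_le_mul_of_nonneg_left (hC p) (abs_nonneg c)

variable (T : BundleRDS X P ϑ)

instance fiber.nonempty (ω : Ω) : Nonempty (T.fiber ω) := (T.fiber_nonempty ω).to_subtype

theorem fst_skew_iterate (n : ℕ) (p : T.graph) : (T.skew^[n] p).1.1 = ϑ^[n] p.1.1 := by
  rw [T.skew_iterate n p.1.1 ⟨p.1.2, p.2⟩]

variable {T}

theorem bddAbove_fiber {F : T.graph → ℝ} {C : ℝ} (hC : ∀ p, F p ≤ C) (ω : Ω) :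
    BddAbove (range fun x : T.fiber ω => F ⟨(ω, x), x.2⟩) :=
  ⟨C, by rintro _ ⟨x, rfl⟩; exact hC _⟩

theorem le_fiberSup {F : T.graph → ℝ} {C : ℝ} (hC : ∀ p, F p ≤ C) (p : T.graph) :
    F p ≤ T.fiberSup F p.1.1 :=
  le_ciSup (bddAbove_fiber hC p.1.1) (⟨p.1.2, p.2⟩ : T.fiber p.1.1)

theorem fiberSup_le {F : T.graph → ℝ} {ω : Ω} {c : ℝ} (h : ∀ p : T.graph, p.1.1 = ω → F p ≤ c) :
    T.fiberSup F ω ≤ c :=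
  ciSup_le fun x => h ⟨(ω, x), x.2⟩ rfl

theorem abs_fiberSup_le {F : T.graph → ℝ} {C : ℝ} (hC : ∀ p, |F p| ≤ C) (ω : Ω) :
    |T.fiberSup F ω| ≤ C := by
  obtain ⟨x, hx⟩ := T.fiber_nonempty ω
  refine abs_le.2 ⟨?_, fiberSup_le fun p _ => (abs_le.1 (hC p)).2⟩
  exact (abs_le.1 (hC ⟨(ω, x), hx⟩)).1.trans (le_fiberSup (fun p => (abs_le.1 (hC p)).2) _)

theorem exists_abs_le (F : T.boundedMeasurable) : ∃ C, ∀ p, |F.1 p| ≤ C := F.2.2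

theorem birkhoffSum_mem (F : T.boundedMeasurable) (n : ℕ) :
    birkhoffSum T.skew F.1 n ∈ T.boundedMeasurable := by
  obtain ⟨hF, C, hC⟩ := F.2
  refine ⟨?_, n * C, fun p => ?_⟩
  · exact Finset.measurable_sum _ fun i _ => hF.comp (T.measurable_skew.iterate i)
  · refine (Finset.abs_sum_le_sum_abs _ _).trans ?_
    simpa using Finset.sum_le_card_nsmul (Finset.range n) _ C fun i _ => hC _

theorem comp_skew_mem (F : T.boundedMeasurable) : F.1 ∘ T.skew ∈ T.boundedMeasurable :=
  ⟨F.2.1.comp T.measurable_skew, F.2.2.imp fun _ hC _ => hC _⟩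

theorem fiberSup_add_le (F G : T.boundedMeasurable) (ω : Ω) :
    T.fiberSup (F.1 + G.1) ω ≤ T.fiberSup F.1 ω + T.fiberSup G.1 ω := by
  obtain ⟨C, hC⟩ := exists_abs_le F
  obtain ⟨D, hD⟩ := exists_abs_le G
  refine fiberSup_le ?_
  rintro p rfl
  exact add_le_add (le_fiberSup (fun p => (abs_le.1 (hC p)).2) p)
    (le_fiberSup (fun p => (abs_le.1 (hD p)).2) p)

theorem fiberSup_smul {c : ℝ} (hc : 0 ≤ c) (F : T.graph → ℝ) (ω : Ω) :
    T.fiberSup (c • F) ω = c * T.fiberSup F ω :=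
  (Real.mul_iSup_of_nonneg hc _).symm

/-- Cut the orbit at time `m`: the second block starts in the fibre over `ϑ^m ω`, so the supremum
over that whole fibre dominates it. -/
theorem fiberSup_birkhoffSum_add_le (F : T.boundedMeasurable) (m n : ℕ) (ω : Ω) :
    T.fiberSup (birkhoffSum T.skew F.1 (m + n)) ω ≤
      T.fiberSup (birkhoffSum T.skew F.1 m) ω +
        T.fiberSup (birkhoffSum T.skew F.1 n) (ϑ^[m] ω) := by
  obtain ⟨C, hC⟩ := (birkhoffSum_mem F m).2
  obtain ⟨D, hD⟩ := (birkhoffSum_mem F n).2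
  refine fiberSup_le ?_
  rintro p rfl
  rw [birkhoffSum_add, ← fst_skew_iterate]
  exact add_le_add (le_fiberSup (fun p => (abs_le.1 (hC p)).2) p)
    (le_fiberSup (fun p => (abs_le.1 (hD p)).2) _)

end Functional

section Projection

variable {Ω : Type*} [MeasurableSpace Ω] {X : Type*} [MetricSpace X] [CompactSpace X]
  [MeasurableSpace X] [BorelSpace X] {P : Measure Ω} [IsProbabilityMeasure P] [P.IsComplete]
  {ϑ : Ω → Ω} {T : BundleRDS X P ϑ}

/-- The set of base points over which a measurable subset of the bundle has nonempty fibre is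
measurable. -/
theorem measurableSet_exists_mem_fiber {S : Set T.graph} (hS : MeasurableSet S) :
    MeasurableSet {ω | ∃ p ∈ S, p.1.1 = ω} := by
  have h := (T.measurableSet_graph.subtype_image hS).image_fst_of_isComplete P
  rwa [image_image] at h

/-- The set where the supremum exceeds `a` is the projection of the set where `F` does. -/
theorem measurable_fiberSup (F : T.boundedMeasurable) : Measurable (T.fiberSup F.1) := by
  obtain ⟨hF, C, hC⟩ := F.2
  refine measurable_of_Ioi fun a => ?_
  convert measurableSet_exists_mem_fiber (hF measurableSet_Ioi : MeasurableSet (F.1 ⁻¹' Ioi a))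
    using 1
  ext ω
  simp only [mem_preimage, mem_Ioi, mem_ofPred_eq]
  constructor
  · intro h
    obtain ⟨x, hx⟩ := exists_lt_of_lt_ciSup h
    exact ⟨_, hx, rfl⟩
  · rintro ⟨p, hp, rfl⟩
    exact lt_of_lt_of_le hp (le_fiberSup (fun p => (abs_le.1 (hC p)).2) p)

theorem integrable_fiberSup (F : T.boundedMeasurable) : Integrable (T.fiberSup F.1) P := by
  obtain ⟨C, hC⟩ := exists_abs_le F
  exact Integrable.of_bound (measurable_fiberSup F).aestronglyMeasurable C
    (ae_of_all _ (abs_fiberSup_le hC))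

theorem integral_fiberSup_le {F : T.boundedMeasurable} {c : ℝ} (h : ∀ p, F.1 p ≤ c) :
    ∫ ω, T.fiberSup F.1 ω ∂P ≤ c := by
  have := integral_mono (integrable_fiberSup F) (integrable_const c)
    fun ω => fiberSup_le fun p _ => h p
  simpa using this

variable (T) in
/-- The integral of the maximal Birkhoff sum over the fibres. -/
noncomputable def integralMax (F : T.graph → ℝ) (n : ℕ) : ℝ :=
  ∫ ω, T.fiberSup (birkhoffSum T.skew F n) ω ∂P

theorem subadditive_integralMax (F : T.boundedMeasurable) : Subadditive (T.integralMax F.1) := by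
  intro m n
  have hm := integrable_fiberSup ⟨_, birkhoffSum_mem F m⟩
  have hn := integrable_fiberSup ⟨_, birkhoffSum_mem F n⟩
  have hmn := integrable_fiberSup ⟨_, birkhoffSum_mem F (m + n)⟩
  have hmp := T.base_measurePreserving.iterate m
  have hn' : Integrable (fun ω => T.fiberSup (birkhoffSum T.skew F.1 n) (ϑ^[m] ω)) P :=
    hmp.integrable_comp_of_integrable hn
  have hcomp : ∫ ω, T.fiberSup (birkhoffSum T.skew F.1 n) (ϑ^[m] ω) ∂P = T.integralMax F.1 n :=
    hmp.integral_comp_of_aestronglyMeasurable hn.aestronglyMeasurable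
  rw [← hcomp, integralMax, integralMax, ← integral_add hm hn']
  exact integral_mono hmn (hm.add hn') (fiberSup_birkhoffSum_add_le F m n)

theorem exists_tendsto_integralMax_div (F : T.boundedMeasurable) :
    ∃ l, Tendsto (fun n => T.integralMax F.1 n / n) atTop (𝓝 l) := by
  obtain ⟨C, hC⟩ := exists_abs_le F
  refine ⟨_, (subadditive_integralMax F).tendsto_lim ⟨-C, ?_⟩⟩
  rintro _ ⟨n, rfl⟩
  have hC0 : 0 ≤ C := by
    obtain ⟨ω⟩ := P.nonempty_of_neZero
    obtain ⟨x, hx⟩ := T.fiber_nonempty ω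
    exact (abs_nonneg _).trans (hC ⟨(ω, x), hx⟩)
  -- At `n = 0` the quotient is zero by convention, so the lower bound `-C` needs `0 ≤ C`.
  rcases Nat.eq_zero_or_pos n with rfl | hn
  · simpa using hC0
  have hn' : (0 : ℝ) < n := by exact_mod_cast hn
  change -C ≤ T.integralMax F.1 n / n
  rw [le_div_iff₀ hn']
  have hb : ∀ p, |birkhoffSum T.skew F.1 n p| ≤ n * C := fun p => by
    refine (Finset.abs_sum_le_sum_abs _ _).trans ?_
    simpa using Finset.sum_le_card_nsmul (Finset.range n) _ C fun i _ => hC _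
  have := integral_mono (integrable_const (-(n * C)))
    (integrable_fiberSup ⟨_, birkhoffSum_mem F n⟩)
    fun ω => (abs_le.1 (abs_fiberSup_le hb ω)).1
  rw [integral_const] at this
  simp only [probReal_univ, smul_eq_mul, one_mul] at this
  rw [integralMax]
  linarith

variable (T) in
/-- The asymptotic maximal average of a bounded measurable function along orbits. -/
noncomputable def maxAverage (F : T.boundedMeasurable) : ℝ :=
  (exists_tendsto_integralMax_div F).choose

theorem tendsto_maxAverage (F : T.boundedMeasurable) :
    Tendsto (fun n => T.integralMax F.1 n / n) atTop (𝓝 (T.maxAverage F)) :=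
  (exists_tendsto_integralMax_div F).choose_spec

theorem maxAverage_smul {c : ℝ} (hc : 0 ≤ c) (F : T.boundedMeasurable) :
    T.maxAverage (c • F) = c * T.maxAverage F := by
  refine tendsto_nhds_unique (tendsto_maxAverage (c • F)) ?_
  refine ((tendsto_maxAverage F).const_mul c).congr fun n => ?_
  have : birkhoffSum T.skew (c • F).1 n = c • birkhoffSum T.skew F.1 n := by
    ext p
    simp [birkhoffSum, Finset.mul_sum]
  rw [integralMax, integralMax, this]
  simp only [fiberSup_smul hc]
  rw [integral_const_mul, mul_div_assoc]

theorem maxAverage_add_le (F G : T.boundedMeasurable) :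
    T.maxAverage (F + G) ≤ T.maxAverage F + T.maxAverage G := by
  refine le_of_tendsto_of_tendsto' (tendsto_maxAverage (F + G))
    ((tendsto_maxAverage F).add (tendsto_maxAverage G)) fun n => ?_
  have : birkhoffSum T.skew (F + G).1 n = birkhoffSum T.skew F.1 n + birkhoffSum T.skew G.1 n := by
    ext p
    simp [birkhoffSum, Finset.sum_add_distrib]
  rw [← add_div]
  gcongr
  have hF := integrable_fiberSup ⟨_, birkhoffSum_mem F n⟩
  have hG := integrable_fiberSup ⟨_, birkhoffSum_mem G n⟩
  rw [integralMax, integralMax, integralMax, ← integral_add hF hG]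
  refine integral_mono (integrable_fiberSup ⟨_, birkhoffSum_mem (F + G) n⟩) (hF.add hG) fun ω => ?_
  simp only [this]
  exact fiberSup_add_le ⟨_, birkhoffSum_mem F n⟩ ⟨_, birkhoffSum_mem G n⟩ ω

theorem maxAverage_le (F : T.boundedMeasurable) : T.maxAverage F ≤ ∫ ω, T.fiberSup F.1 ω ∂P := by
  have h : ∀ n, T.integralMax F.1 n ≤ n * ∫ ω, T.fiberSup F.1 ω ∂P := by
    intro n
    have h1 : T.integralMax F.1 1 = ∫ ω, T.fiberSup F.1 ω ∂P := by
      simp only [integralMax]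
      congr! 3
      ext p
      simp
    induction n with
    | zero =>
      refine integral_fiberSup_le (F := ⟨_, birkhoffSum_mem F 0⟩) fun p => ?_
      simp
    | succ n ih =>
      have := subadditive_integralMax F n 1
      push_cast
      linarith
  refine le_of_tendsto (tendsto_maxAverage F) ?_
  filter_upwards [eventually_gt_atTop 0] with n hn
  rw [div_le_iff₀ (by exact_mod_cast hn), mul_comm]
  exact h n

/-- Birkhoff sums of a coboundary telescope and stay below `2 * C`. This is what makes every linear
functional dominated by `maxAverage` invariant. -/
theorem maxAverage_comp_skew_sub (F : T.boundedMeasurable) :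
    T.maxAverage (⟨F.1 ∘ T.skew, comp_skew_mem F⟩ - F) ≤ 0 := by
  obtain ⟨C, hC⟩ := exists_abs_le F
  have hlim : Tendsto (fun n : ℕ => 2 * C / n) atTop (𝓝 0) :=
    tendsto_const_div_atTop_nhds_zero_nat (2 * C)
  refine le_of_tendsto_of_tendsto' (tendsto_maxAverage _) hlim fun n => ?_
  gcongr
  refine integral_fiberSup_le (F := ⟨_, birkhoffSum_mem (⟨F.1 ∘ T.skew, comp_skew_mem F⟩ - F) n⟩)
    fun p => ?_
  have : birkhoffSum T.skew (⟨F.1 ∘ T.skew, comp_skew_mem F⟩ - F : T.boundedMeasurable).1 n p =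
      F.1 (T.skew^[n] p) - F.1 p := by
    simp only [birkhoffSum, AddSubgroupClass.coe_sub, Pi.sub_apply, Function.comp_apply,
      ← Function.iterate_succ_apply']
    exact Finset.sum_range_sub (fun i => F.1 (T.skew^[i] p)) n
  change birkhoffSum T.skew (⟨F.1 ∘ T.skew, comp_skew_mem F⟩ - F : T.boundedMeasurable).1 n p ≤ _
  rw [this]
  linarith [(abs_le.1 (hC (T.skew^[n] p))).2, (abs_le.1 (hC p)).1]

/-- An invariant positive functional that attains the asymptotic maximal average of `F₀`. -/
theorem exists_invariant_functional (F₀ : T.boundedMeasurable) :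
    ∃ Λ : T.boundedMeasurable →ₗ[ℝ] ℝ, Λ F₀ = T.maxAverage F₀ ∧
      (∀ F, Λ F ≤ ∫ ω, T.fiberSup F.1 ω ∂P) ∧
      ∀ F : T.boundedMeasurable, Λ ⟨F.1 ∘ T.skew, comp_skew_mem F⟩ = Λ F := by
  have hzero : T.maxAverage 0 = 0 := by
    simpa using maxAverage_smul le_rfl (0 : T.boundedMeasurable)
  have hspan : ∀ c : ℝ, c • F₀ = 0 → c • T.maxAverage F₀ = 0 := fun c hc => by
    rcases smul_eq_zero.1 hc with rfl | h
    · simp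
    · simp [h, hzero]
  obtain ⟨Λ, hΛ, hle⟩ := exists_extension_of_le_sublinear
    (LinearPMap.mkSpanSingleton' F₀ (T.maxAverage F₀) hspan) T.maxAverage
    (fun c hc F => maxAverage_smul hc.le F) maxAverage_add_le (by
      rintro ⟨F, hF⟩
      obtain ⟨c, rfl⟩ := Submodule.mem_span_singleton.1 hF
      rw [LinearPMap.mkSpanSingleton'_apply, smul_eq_mul]
      rcases le_total 0 c with hc | hc
      · exact (maxAverage_smul hc F₀).ge
      -- For negative `c`, subadditivity applied to `c • F₀` and its negative bounds `maxAverage (c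
      -- • F₀)` from below.
      · have h1 := maxAverage_smul (neg_nonneg.2 hc) F₀
        have h2 := maxAverage_add_le (c • F₀) (-c • F₀)
        rw [← add_smul, add_neg_cancel, zero_smul, hzero, h1] at h2
        change c * T.maxAverage F₀ ≤ T.maxAverage (c • F₀)
        linarith)
  have hinv : ∀ F : T.boundedMeasurable, Λ ⟨F.1 ∘ T.skew, comp_skew_mem F⟩ ≤ Λ F := fun F => by
    have := (hle _).trans (maxAverage_comp_skew_sub F)
    rw [map_sub] at this
    linarith
  refine ⟨Λ, ?_, fun F => (hle F).trans (maxAverage_le F), fun F => (hinv F).antisymm ?_⟩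
  · have := hΛ ⟨F₀, Submodule.mem_span_singleton_self F₀⟩
    exact this.trans (LinearPMap.mkSpanSingleton'_apply_self _ _ hspan _)
  · have := hinv (-F)
    have h2 : (⟨(-F).1 ∘ T.skew, comp_skew_mem (-F)⟩ : T.boundedMeasurable) =
        -⟨F.1 ∘ T.skew, comp_skew_mem F⟩ := rfl
    rw [h2, map_neg, map_neg] at this
    linarith

end Projection

end BundleRDS

/-! ### Representation of the functional by an invariant measure. -/

theorem MeasureTheory.Measure.ext_of_setIntegral_prod_univ {Ω X : Type*} [MeasurableSpace Ω]
    [MetricSpace X] [CompactSpace X] [MeasurableSpace X] [BorelSpace X] {μ ν : Measure (Ω × X)}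
    [IsFiniteMeasure μ] [IsFiniteMeasure ν]
    (h : ∀ A, MeasurableSet A → ∀ f : C(X, ℝ),
      ∫ p in A ×ˢ univ, f p.2 ∂μ = ∫ p in A ×ˢ univ, f p.2 ∂ν) : μ = ν := by
  have hA : ∀ A, MeasurableSet A →
      (μ.restrict (A ×ˢ univ)).map Prod.snd = (ν.restrict (A ×ˢ univ)).map Prod.snd :=
    fun A hA => ext_of_forall_integral_eq_of_IsFiniteMeasure fun f => by
      rw [integral_map measurable_snd.aemeasurable f.continuous.measurable.aestronglyMeasurable,
        integral_map measurable_snd.aemeasurable f.continuous.measurable.aestronglyMeasurable]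
      exact h A hA f.toContinuousMap
  refine Measure.ext_prod fun {A B} hAm hBm => ?_
  have h2 := congrArg (fun m => m B) (hA A hAm)
  rw [Measure.map_apply measurable_snd hBm, Measure.map_apply measurable_snd hBm,
    Measure.restrict_apply (measurable_snd hBm), Measure.restrict_apply (measurable_snd hBm)] at h2
  have hset : Prod.snd ⁻¹' B ∩ A ×ˢ univ = A ×ˢ B := by
    ext ⟨ω, x⟩
    simp [and_comm]
  rwa [hset] at h2

namespace BundleRDS

variable {Ω : Type*} [MeasurableSpace Ω] {X : Type*} [MetricSpace X] [CompactSpace X]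
  [MeasurableSpace X] [BorelSpace X] {P : Measure Ω} {ϑ : Ω → Ω}

theorem _root_.ContinuousMap.exists_abs_apply_le {X : Type*} [TopologicalSpace X] [CompactSpace X]
    (f : C(X, ℝ)) : ∃ C, ∀ x, |f x| ≤ C :=
  ⟨‖f‖, fun x => f.norm_coe_le_norm x⟩

theorem indicator_mem_boundedMeasurable (T : BundleRDS X P ϑ) {A : Set Ω} (hA : MeasurableSet A)
    (f : C(X, ℝ)) :
    (fun p : T.graph => A.indicator (fun _ => f p.1.2) p.1.1) ∈ T.boundedMeasurable := by
  obtain ⟨C, hC⟩ := f.exists_abs_apply_le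
  refine ⟨?_, C, fun p => ?_⟩
  · have h1 : Measurable fun p : T.graph => f p.1.2 :=
      f.continuous.measurable.comp (measurable_snd.comp measurable_subtype_coe)
    have h2 : MeasurableSet {p : T.graph | p.1.1 ∈ A} :=
      (measurable_fst.comp measurable_subtype_coe) hA
    exact h1.indicator h2
  · by_cases h : p.1.1 ∈ A
    · simpa [h] using hC p.1.2
    · simpa [h] using (abs_nonneg _).trans (hC p.1.2)

/-- The function `(ω, x) ↦ 1_A(ω) f(x)` on the bundle, as a linear function of `f`. -/
noncomputable def indicatorMap (T : BundleRDS X P ϑ) {A : Set Ω} (hA : MeasurableSet A) :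
    C(X, ℝ) →ₗ[ℝ] T.boundedMeasurable where
  toFun f := ⟨_, T.indicator_mem_boundedMeasurable hA f⟩
  map_add' f g := by
    ext p
    by_cases h : p.1.1 ∈ A <;> simp [h]
  map_smul' c f := by
    ext p
    by_cases h : p.1.1 ∈ A <;> simp [h]

theorem indicatorMap_apply (T : BundleRDS X P ϑ) {A : Set Ω} (hA : MeasurableSet A) (f : C(X, ℝ))
    (p : T.graph) : (T.indicatorMap hA f).1 p = A.indicator (fun _ => f p.1.2) p.1.1 := rfl

variable {T : BundleRDS X P ϑ} {Λ : T.boundedMeasurable →ₗ[ℝ] ℝ}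

/-- On the bundle, the functional of a measurable family of continuous functions with finitely many
values is an integral. -/
theorem functional_simpleFunc {m : Measure (Ω × X)} [IsProbabilityMeasure m]
    (hm : ∀ A (hA : MeasurableSet A) (f : C(X, ℝ)),
        ∫ p in A ×ˢ univ, f p.2 ∂m = Λ (T.indicatorMap hA f))
    (s : SimpleFunc Ω C(X, ℝ)) :
    ∃ F : T.boundedMeasurable, (∀ p, F.1 p = s p.1.1 p.1.2) ∧
      Integrable (fun p : Ω × X => s p.1 p.2) m ∧ ∫ p, s p.1 p.2 ∂m = Λ F := by
  classical
  induction s using SimpleFunc.induction with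
  | @const f A hA =>
    refine ⟨T.indicatorMap hA f, fun p => ?_, ?_, ?_⟩
    · by_cases h : p.1.1 ∈ A <;> simp [indicatorMap_apply, h]
    all_goals
      have h : (fun p : Ω × X => (SimpleFunc.piecewise A hA (SimpleFunc.const Ω f)
          (SimpleFunc.const Ω 0)) p.1 p.2) = (A ×ˢ univ).indicator fun p => f p.2 := by
        ext p
        by_cases h : p.1 ∈ A <;> simp [h, indicator]
      rw [h]
    · obtain ⟨C, hC⟩ := f.exists_abs_apply_le
      refine Integrable.indicator ?_ (hA.prod .univ)
      exact Integrable.of_bound (f.continuous.measurable.comp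
        measurable_snd).aestronglyMeasurable C (ae_of_all _ fun p => hC p.2)
    · rw [integral_indicator (hA.prod .univ), hm A hA f]
  | @add s t _ hs ht =>
    obtain ⟨F, hF, hsi, hFi⟩ := hs
    obtain ⟨G, hG, hti, hGi⟩ := ht
    refine ⟨F + G, fun p => ?_, hsi.add hti, ?_⟩
    · simp [hF, hG]
    · rw [map_add, ← hFi, ← hGi, ← integral_add hsi hti]
      rfl

/-- The function is constant on fibres, so domination applied to it and to its negative pins the
value from both sides. -/
theorem functional_indicatorMap_one (hΛ : ∀ F, Λ F ≤ ∫ ω, T.fiberSup F.1 ω ∂P) {A : Set Ω}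
    (hA : MeasurableSet A) : Λ (T.indicatorMap hA 1) = P.real A := by
  have h1 : T.fiberSup (T.indicatorMap hA 1).1 = A.indicator 1 := by
    ext ω
    simp only [fiberSup, indicatorMap_apply, ContinuousMap.one_apply]
    exact ciSup_const
  have h2 : T.fiberSup (-T.indicatorMap hA 1).1 = -A.indicator 1 := by
    ext ω
    simp only [fiberSup, indicatorMap_apply, Submodule.coe_neg, Pi.neg_apply,
      ContinuousMap.one_apply]
    exact ciSup_const
  refine le_antisymm ((hΛ _).trans ?_) ?_
  · rw [h1, integral_indicator_one hA]
  · have := hΛ (-T.indicatorMap hA 1)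
    rw [h2, map_neg] at this
    simp only [Pi.neg_apply] at this
    rw [integral_neg, integral_indicator_one hA] at this
    linarith

variable [IsProbabilityMeasure P] [P.IsComplete]

theorem functional_mono (hΛ : ∀ F, Λ F ≤ ∫ ω, T.fiberSup F.1 ω ∂P) {F G : T.boundedMeasurable}
    (h : ∀ p, F.1 p ≤ G.1 p) : Λ F ≤ Λ G := by
  have h1 := (hΛ (F - G)).trans (integral_fiberSup_le (c := 0) fun p => by
    simpa using h p)
  rw [map_sub] at h1
  linarith

/-- A functional dominated by the integral of the fibrewise supremum is represented by a measure
with marginal `P`. -/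
theorem exists_measure_of_functional (hΛ : ∀ F, Λ F ≤ ∫ ω, T.fiberSup F.1 ω ∂P) :
    ∃ m : Measure (Ω × X), IsProbabilityMeasure m ∧ m.map Prod.fst = P ∧
      ∀ A (hA : MeasurableSet A) (f : C(X, ℝ)),
        ∫ p in A ×ˢ univ, f p.2 ∂m = Λ (T.indicatorMap hA f) := by
  refine exists_measure_setIntegral_eq P (fun A hA => Λ ∘ₗ T.indicatorMap hA) (fun A hA f hf => ?_)
    (fun A hA => functional_indicatorMap_one hΛ hA) fun A hA B hB f hd => ?_
  · rw [← map_zero (Λ ∘ₗ T.indicatorMap hA)]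
    refine functional_mono hΛ fun p => ?_
    rw [indicatorMap_apply, indicatorMap_apply]
    exact indicator_le_indicator (hf p.1.2)
  · simp only [LinearMap.comp_apply]
    rw [← map_add]
    congr 1
    ext p
    simp only [Submodule.coe_add, Pi.add_apply, indicatorMap_apply]
    exact congrFun (indicator_union_of_disjoint hd _) p.1.1

/-- The representing measure is carried by the bundle. -/
theorem ae_mem_graph_of_functional {m : Measure (Ω × X)} [IsProbabilityMeasure m]
    (hm : ∀ A (hA : MeasurableSet A) (f : C(X, ℝ)),
        ∫ p in A ×ˢ univ, f p.2 ∂m = Λ (T.indicatorMap hA f)) : ∀ᵐ p ∂m, p ∈ T.graph := by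
  have key : ∀ U : Set X, IsOpen U → ∀ᵐ p ∂m, (∃ q : T.graph, q.1.2 ∈ U ∧ q.1.1 = p.1) ∨ p.2 ∉ U := by
    intro U hU
    -- The distance to the empty set is zero by convention, so `U = X` is treated separately.
    rcases eq_empty_or_nonempty Uᶜ with hUe | hUne
    · refine ae_of_all _ fun p => Or.inl ?_
      obtain ⟨x, hx⟩ := T.fiber_nonempty p.1
      exact ⟨⟨(p.1, x), hx⟩, (compl_empty_iff.1 hUe).symm ▸ mem_univ _, rfl⟩
    have hUm : MeasurableSet {q : T.graph | q.1.2 ∈ U} :=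
      (measurable_snd.comp measurable_subtype_coe) hU.measurableSet
    have hA := (measurableSet_exists_mem_fiber hUm).compl
    set A : Set Ω := {ω | ∃ p ∈ {q : T.graph | q.1.2 ∈ U}, p.1.1 = ω}ᶜ with hAdef
    -- This function is positive exactly on `U`, yet vanishes on the part of the bundle over `A`,
    -- where the fibres miss `U`.
    let f : C(X, ℝ) := ⟨fun x => Metric.infDist x Uᶜ, Metric.continuous_infDist_pt _⟩
    have hf : T.indicatorMap hA f = 0 := by
      ext p
      rw [indicatorMap_apply]
      by_cases hp : p.1.1 ∈ A
      · rw [indicator_of_mem hp]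
        refine Metric.infDist_zero_of_mem fun hpU => hp ⟨p, hpU, rfl⟩
      · rw [indicator_of_notMem hp]
        rfl
    have h0 := hm A hA f
    rw [hf, map_zero] at h0
    have hint : Integrable (fun p : Ω × X => f p.2) (m.restrict (A ×ˢ univ)) := by
      obtain ⟨C, hC⟩ := f.exists_abs_apply_le
      exact Integrable.of_bound (f.continuous.measurable.comp
        measurable_snd).aestronglyMeasurable C (ae_of_all _ fun p => hC p.2)
    have hf0 : 0 ≤ fun p : Ω × X => f p.2 := fun p => Metric.infDist_nonneg
    rw [integral_eq_zero_iff_of_nonneg hf0 hint, EventuallyEq,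
      ae_restrict_iff' (hA.prod .univ)] at h0
    filter_upwards [h0] with p hp
    by_cases hpA : p.1 ∈ A
    · right
      have h1 := (hU.isClosed_compl.mem_iff_infDist_zero hUne).2 (hp ⟨hpA, mem_univ _⟩)
      exact h1
    · left
      simpa [hAdef] using hpA
  have hb := TopologicalSpace.isBasis_countableBasis X
  have hall : ∀ᵐ p ∂m, ∀ U ∈ TopologicalSpace.countableBasis X,
      (∃ q : T.graph, q.1.2 ∈ U ∧ q.1.1 = p.1) ∨ p.2 ∉ U :=
    (ae_ball_iff (TopologicalSpace.countable_countableBasis X)).2 fun U hU => key U (hb.isOpen hU)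
  filter_upwards [hall] with p hp
  by_contra hpg
  -- A point off the bundle lies in a basic open set that misses its fibre, and such points form a
  -- null set by `hall`.
  have hopen : IsOpen (T.fiber p.1)ᶜ := (T.fiber_isCompact p.1).isClosed.isOpen_compl
  obtain ⟨U, hU, hpU, hUs⟩ := hb.exists_subset_of_mem_open (show p.2 ∈ (T.fiber p.1)ᶜ from hpg) hopen
  rcases hp U hU with ⟨q, hqU, hq⟩ | h
  · have : q.1 = (p.1, q.1.2) := Prod.ext hq rfl
    exact hUs hqU (this ▸ q.2)
  · exact h hpU

/-- The functional is bounded below by the integral, on nonnegative functions that are continuous on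
almost every fibre. -/
theorem integral_le_functional_of_nonneg (hΛ : ∀ F, Λ F ≤ ∫ ω, T.fiberSup F.1 ω ∂P)
    {m : Measure (Ω × X)} [IsProbabilityMeasure m] (hfst : m.map Prod.fst = P)
    (hm : ∀ A (hA : MeasurableSet A) (f : C(X, ℝ)),
        ∫ p in A ×ˢ univ, f p.2 ∂m = Λ (T.indicatorMap hA f))
    (G : T.boundedMeasurable) (hG0 : ∀ p, 0 ≤ G.1 p)
    (hG : ∀ᵐ ω ∂P, Continuous fun x : T.fiber ω => G.1 ⟨(ω, x), x.2⟩) :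
    ∫ p, G.1 p ∂(m.comap Subtype.val) ≤ Λ G := by
  have hgraph := ae_mem_graph_of_functional hm
  have hrestr : m.restrict T.graph = m := Measure.restrict_eq_self_of_ae_mem hgraph
  obtain ⟨C, hC⟩ := exists_abs_le G
  let g : ℕ → C(X, ℝ) := TopologicalSpace.denseSeq C(X, ℝ)
  have hAc : ∀ j, MeasurableSet {ω | ∃ p ∈ {p : T.graph | G.1 p < g j p.1.2}, p.1.1 = ω} :=
    fun j => measurableSet_exists_mem_fiber (measurableSet_lt G.2.1
      ((g j).continuous.measurable.comp (measurable_snd.comp measurable_subtype_coe)))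
  -- Over `A j` the function `g j` lies below `G` on the whole fibre. The `s n` are increasing
  -- minorants of `G`: maxima of `0` and finitely many `1_{A j} g j`.
  let A : ℕ → Set Ω := fun j => {ω | ∃ p ∈ {p : T.graph | G.1 p < g j p.1.2}, p.1.1 = ω}ᶜ
  have hA : ∀ j, MeasurableSet (A j) := fun j => (hAc j).compl
  have hAle : ∀ j (p : T.graph), p.1.1 ∈ A j → g j p.1.2 ≤ G.1 p := fun j p hp =>
    not_lt.1 fun hlt => hp ⟨p, hlt, rfl⟩
  let s : ℕ → SimpleFunc Ω C(X, ℝ) := fun n => Nat.rec (SimpleFunc.const Ω 0) (fun j s =>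
    s ⊔ SimpleFunc.piecewise (A j) (hA j) (SimpleFunc.const Ω (g j)) (SimpleFunc.const Ω 0)) n
  have hs : ∀ n ω x, s (n + 1) ω x = max (s n ω x) ((A n).indicator (fun _ => g n x) ω) := by
    intro n ω x
    change (s n ⊔ SimpleFunc.piecewise (A n) (hA n) (SimpleFunc.const Ω (g n))
      (SimpleFunc.const Ω 0)) ω x = _
    by_cases h : ω ∈ A n <;> simp [h]
  have hs0 : ∀ n ω x, 0 ≤ s n ω x := by
    intro n ω x
    induction n with
    | zero => exact le_rfl
    | succ n ih => rw [hs]; exact le_max_of_le_left ih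
  have hsG : ∀ n (p : T.graph), s n p.1.1 p.1.2 ≤ G.1 p := by
    intro n p
    induction n with
    | zero => exact hG0 p
    | succ n ih =>
      rw [hs]
      refine max_le ih ?_
      by_cases h : p.1.1 ∈ A n
      · simpa [h] using hAle n p h
      · simpa [h] using hG0 p
  have hsmono : ∀ ω x, Monotone fun n => s n ω x := fun ω x =>
    monotone_nat_of_le_succ fun n => by rw [hs]; exact le_max_left _ _
  have hlim : ∀ᵐ p : T.graph ∂(m.comap Subtype.val),
      Tendsto (fun n => s n p.1.1 p.1.2) atTop (𝓝 (G.1 p)) := by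
    have hfstq : Measure.QuasiMeasurePreserving (fun p : T.graph => p.1.1)
        (m.comap Subtype.val) P := by
      refine ⟨measurable_fst.comp measurable_subtype_coe, Measure.absolutelyContinuous_of_eq ?_⟩
      have h1 : (fun p : T.graph => p.1.1) = Prod.fst ∘ Subtype.val := rfl
      rw [h1, ← Measure.map_map measurable_fst measurable_subtype_coe,
        map_comap_subtype_coe T.measurableSet_graph, hrestr, hfst]
    filter_upwards [hfstq.ae hG] with p hp
    refine tendsto_atTop_isLUB (hsmono _ _) ⟨?_, fun b hb => ?_⟩
    · rintro _ ⟨n, rfl⟩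
      exact hsG n p
    refine le_of_forall_pos_lt_add fun δ hδ => ?_
    -- Extend `G` from the fibre by Tietze and approximate the extension minus `δ / 2` within `δ /
    -- 2`. The resulting `g j` lies between `G - δ` and `G` on this fibre.
    obtain ⟨h, hh⟩ := ContinuousMap.exists_restrict_eq (T.fiber_isCompact p.1.1).isClosed ⟨_, hp⟩
    have hh' : ∀ x : T.fiber p.1.1, h x = G.1 ⟨(p.1.1, x), x.2⟩ := fun x =>
      congrArg (fun k : C(T.fiber p.1.1, ℝ) => k x) hh
    obtain ⟨j, hj⟩ := (TopologicalSpace.denseRange_denseSeq C(X, ℝ)).exists_dist_lt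
      (h - ContinuousMap.const X (δ / 2)) (half_pos hδ)
    have hj' : ∀ x, |h x - δ / 2 - g j x| < δ / 2 := fun x =>
      lt_of_le_of_lt (ContinuousMap.dist_apply_le_dist
        (f := h - ContinuousMap.const X (δ / 2)) (g := g j) x) hj
    have hpA : p.1.1 ∈ A j := by
      rintro ⟨q, hq, hqp⟩
      obtain ⟨⟨ω, x⟩, hωx⟩ := q
      obtain rfl : ω = p.1.1 := hqp
      have h1 := hh' ⟨x, hωx⟩
      have h2 := abs_lt.1 (hj' x)
      simp only [mem_ofPred_eq] at hq h1
      linarith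
    have h1 := hh' ⟨p.1.2, p.2⟩
    have h2 := abs_lt.1 (hj' p.1.2)
    have h3 : s (j + 1) p.1.1 p.1.2 ≤ b := hb ⟨j + 1, rfl⟩
    rw [hs, indicator_of_mem hpA] at h3
    have h4 := (le_max_right _ _).trans h3
    simp only [Prod.mk.eta, Subtype.coe_eta] at h1
    linarith
  have hmeas : ∀ n, Measurable fun p : T.graph => s n p.1.1 p.1.2 := fun n => by
    obtain ⟨F, hF, -, -⟩ := functional_simpleFunc hm (s n)
    exact (funext hF : F.1 = _) ▸ F.2.1
  have hfin : IsFiniteMeasure (m.comap (Subtype.val : T.graph → Ω × X)) := by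
    infer_instance
  have htend := tendsto_integral_of_dominated_convergence (fun _ => C)
    (fun n => (hmeas n).aestronglyMeasurable) (integrable_const C)
    (fun n => ae_of_all _ fun p => by
      rw [Real.norm_of_nonneg (hs0 _ _ _)]
      exact (hsG n p).trans (abs_le.1 (hC p)).2) hlim
  refine le_of_tendsto' htend fun n => ?_
  obtain ⟨F, hF, hFi, hFΛ⟩ := functional_simpleFunc hm (s n)
  have : ∫ p : T.graph, s n p.1.1 p.1.2 ∂(m.comap Subtype.val) = Λ F := by
    rw [← hFΛ, integral_subtype_comap T.measurableSet_graph fun p => s n p.1 p.2, hrestr]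
  rw [this]
  exact functional_mono hΛ fun p => by rw [hF]; exact hsG n p

/-- The functional is the integral, on functions that are continuous on almost every fibre. -/
theorem integral_eq_functional (hΛ : ∀ F, Λ F ≤ ∫ ω, T.fiberSup F.1 ω ∂P)
    {m : Measure (Ω × X)} [IsProbabilityMeasure m] (hfst : m.map Prod.fst = P)
    (hm : ∀ A (hA : MeasurableSet A) (f : C(X, ℝ)),
        ∫ p in A ×ˢ univ, f p.2 ∂m = Λ (T.indicatorMap hA f))
    (G : T.boundedMeasurable)
    (hG : ∀ᵐ ω ∂P, Continuous fun x : T.fiber ω => G.1 ⟨(ω, x), x.2⟩) :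
    ∫ p, G.1 p ∂(m.comap Subtype.val) = Λ G := by
  obtain ⟨C, hC⟩ := exists_abs_le G
  have hrestr : m.restrict T.graph = m :=
    Measure.restrict_eq_self_of_ae_mem (ae_mem_graph_of_functional hm)
  have hprob : IsProbabilityMeasure (m.comap (Subtype.val : T.graph → Ω × X)) := ⟨by
    rw [comap_subtype_coe_apply T.measurableSet_graph, image_univ, Subtype.range_coe_subtype]
    exact prob_compl_eq_zero_iff T.measurableSet_graph |>.1 (ae_mem_graph_of_functional hm)⟩
  have hGi : Integrable G.1 (m.comap Subtype.val) :=
    Integrable.of_bound G.2.1.aestronglyMeasurable C (ae_of_all _ hC)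
  -- Both `C + G` and `C - G` are nonnegative, so the one-sided bound for them gives equality for
  -- `G`.
  let I : T.boundedMeasurable := C • T.indicatorMap .univ 1
  have hI : ∀ p, I.1 p = C := fun p => by
    change C * (T.indicatorMap .univ 1).1 p = C
    simp [indicatorMap_apply]
  have hΛI : Λ I = C := by
    rw [map_smul, functional_indicatorMap_one hΛ]
    simp
  have hle := integral_le_functional_of_nonneg hΛ hfst hm (I + G)
    (fun p => by
      change 0 ≤ I.1 p + G.1 p
      linarith [hI p, (abs_le.1 (hC p)).1])
    (hG.mono fun ω hω => by
      change Continuous fun x : T.fiber ω => I.1 _ + G.1 _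
      simp only [hI]
      exact hω.const_add C)
  have hge := integral_le_functional_of_nonneg hΛ hfst hm (I - G)
    (fun p => by
      change 0 ≤ I.1 p - G.1 p
      linarith [hI p, (abs_le.1 (hC p)).2])
    (hG.mono fun ω hω => by
      change Continuous fun x : T.fiber ω => I.1 _ - G.1 _
      simp only [hI]
      exact continuous_const.sub hω)
  have h1 : ∫ p, (I + G).1 p ∂(m.comap Subtype.val) = C + ∫ p, G.1 p ∂(m.comap Subtype.val) := by
    change ∫ p, I.1 p + G.1 p ∂(m.comap Subtype.val) = _
    simp only [hI]
    rw [integral_add (integrable_const C) hGi]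
    simp
  have h2 : ∫ p, (I - G).1 p ∂(m.comap Subtype.val) = C - ∫ p, G.1 p ∂(m.comap Subtype.val) := by
    change ∫ p, I.1 p - G.1 p ∂(m.comap Subtype.val) = _
    simp only [hI]
    rw [integral_sub (integrable_const C) hGi]
    simp
  rw [h1, map_add, hΛI] at hle
  rw [h2, map_sub, hΛI] at hge
  linarith

/-- An invariant functional dominated by the integral of the fibrewise supremum is represented by
an invariant measure. -/
theorem exists_mem_invariantMeasures (hΛ : ∀ F, Λ F ≤ ∫ ω, T.fiberSup F.1 ω ∂P)
    (hinv : ∀ F : T.boundedMeasurable, Λ ⟨F.1 ∘ T.skew, comp_skew_mem F⟩ = Λ F) :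
    ∃ m ∈ T.invariantMeasures, ∀ f : C(X, ℝ), ∫ p, f p.2 ∂m = Λ (T.indicatorMap .univ f) := by
  obtain ⟨m, hprob, hfst, hm⟩ := exists_measure_of_functional hΛ
  have hae := ae_mem_graph_of_functional hm
  have hrestr : m.restrict T.graph = m := Measure.restrict_eq_self_of_ae_mem hae
  have hmap : (m.comap Subtype.val).map (Subtype.val : T.graph → Ω × X) = m := by
    rw [map_comap_subtype_coe T.measurableSet_graph, hrestr]
  refine ⟨m, ⟨hprob, hfst, (prob_compl_eq_zero_iff T.measurableSet_graph).1 hae,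
    T.measurable_skew, ?_⟩, fun f => ?_⟩
  swap
  · rw [← hm, univ_prod_univ, Measure.restrict_univ]
  have hemb : MeasurableEmbedding (Subtype.val : T.graph → Ω × X) :=
    MeasurableEmbedding.subtype_coe T.measurableSet_graph
  have hcont : ∀ A (hA : MeasurableSet A) (f : C(X, ℝ)) (ω : Ω),
      Continuous fun x : T.fiber ω => (T.indicatorMap hA f).1 ⟨(ω, x), x.2⟩ := fun A hA f ω => by
    simp only [indicatorMap_apply]
    by_cases h : ω ∈ A
    · simpa [h, Function.comp_def] using f.continuous.comp continuous_subtype_val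
    · simpa [h] using continuous_const
  suffices h : ((m.comap Subtype.val).map T.skew).map Subtype.val =
      (m.comap Subtype.val).map (Subtype.val : T.graph → Ω × X) by
    have := congrArg (Measure.comap (Subtype.val : T.graph → Ω × X)) h
    rwa [hemb.comap_map, hemb.comap_map] at this
  refine Measure.ext_of_setIntegral_prod_univ fun A hA f => ?_
  have hind : ∀ n : Measure T.graph, ∫ p in A ×ˢ univ, f p.2 ∂(n.map Subtype.val) =
      ∫ p, (T.indicatorMap hA f).1 p ∂n := fun n => by
    rw [← integral_indicator (hA.prod .univ), hemb.integral_map]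
    refine integral_congr_ae (ae_of_all _ fun p => ?_)
    by_cases h : p.1.1 ∈ A <;> simp [indicatorMap_apply, indicator, h]
  rw [hind, hind, integral_map T.measurable_skew.aemeasurable
    (T.indicatorMap hA f).2.1.aestronglyMeasurable,
    integral_eq_functional hΛ hfst hm _ (ae_of_all _ (hcont A hA f)), ← hinv,
    ← integral_eq_functional hΛ hfst hm]
  · rfl
  -- Almost sure continuity of `T_ω` keeps `(1_A f) ∘ Θ` in the class on which `Λ` is an integral.
  · filter_upwards [T.continuous_map] with ω hω
    exact (hcont A hA f (ϑ ω)).comp hω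

end BundleRDS

/-! ### Counting visits, and smallness of null closed sets. -/

theorem sum_range_le_sum_range_add {a : ℕ → ℝ} (h0 : ∀ k, 0 ≤ a k) (h1 : ∀ k, a k ≤ 1) (n j : ℕ) :
    ∑ i ∈ Finset.range n, a i ≤ ∑ i ∈ Finset.range n, a (j + i) + j := by
  have h2 : ∑ i ∈ Finset.range n, a i ≤ ∑ i ∈ Finset.range (j + n), a i :=
    Finset.sum_le_sum_of_subset_of_nonneg (Finset.range_mono (by lia)) fun i _ _ => h0 i
  have h3 : ∑ i ∈ Finset.range j, a i ≤ j := by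
    simpa using Finset.sum_le_card_nsmul (Finset.range j) a 1 fun i _ => h1 i
  rw [Finset.sum_range_add] at h2
  linarith

/-- Exchanging the sums gives `m` shifted copies of the `n`-step sum. A shift by `j ≤ m` loses at
most `j`, whence the total error `m ^ 2`. -/
theorem mul_birkhoffSum_le {α : Type*} (θ : α → α) {F : α → ℝ} (h0 : ∀ p, 0 ≤ F p)
    (h1 : ∀ p, F p ≤ 1) (m n : ℕ) (p : α) :
    m * birkhoffSum θ F n p ≤ birkhoffSum θ (birkhoffSum θ F m) n p + m ^ 2 := by
  have hswap : birkhoffSum θ (birkhoffSum θ F m) n p =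
      ∑ j ∈ Finset.range m, ∑ i ∈ Finset.range n, F (θ^[j + i] p) := by
    simp only [birkhoffSum, ← Function.iterate_add_apply]
    exact Finset.sum_comm
  have hj : ∀ j ∈ Finset.range m, birkhoffSum θ F n p - m ≤
      ∑ i ∈ Finset.range n, F (θ^[j + i] p) := fun j hj => by
    have h2 := sum_range_le_sum_range_add (a := fun k => F (θ^[k] p)) (fun k => h0 _)
      (fun k => h1 _) n j
    have h3 : (j : ℝ) ≤ m := by exact_mod_cast (Finset.mem_range.1 hj).le
    rw [birkhoffSum]
    linarith
  have h4 := Finset.card_nsmul_le_sum _ _ _ hj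
  rw [hswap]
  simp only [Finset.card_range, nsmul_eq_mul] at h4
  linarith

/-- Spheres of different radii are disjoint, and a finite measure charges only countably many
disjoint measurable sets. -/
theorem MeasureTheory.Measure.countable_setOf_sphere_ne_zero {Ω X : Type*} [MeasurableSpace Ω]
    [PseudoMetricSpace X] [MeasurableSpace X] [OpensMeasurableSpace X] (μ : Measure (Ω × X)) [IsFiniteMeasure μ] (x : X) :
    {r : ℝ | 0 < r ∧ μ (univ ×ˢ Metric.sphere x r) ≠ 0}.Countable := by
  have h := Measure.countable_meas_pos_of_disjoint_iUnion (μ := μ)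
    (As := fun r : ℝ => (univ : Set Ω) ×ˢ Metric.sphere x r)
    (fun r => MeasurableSet.univ.prod Metric.isClosed_sphere.measurableSet)
    fun r s hrs => disjoint_left.2 fun p hp hq => hrs (hp.2.symm.trans hq.2)
  exact h.mono fun r hr => pos_iff_ne_zero.2 hr.2

namespace BundleRDS

section Visits

variable {Ω : Type*} [MeasurableSpace Ω] {X : Type*} [TopologicalSpace X] [MeasurableSpace X]
  {P : Measure Ω} {ϑ : Ω → Ω} (T : BundleRDS X P ϑ)

theorem bddAbove_visits (E : Set X) (n : ℕ) (ω : Ω) :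
    BddAbove (range fun x : T.fiber ω =>
      ∑ i ∈ Finset.range n, E.indicator (fun _ => (1 : ℝ)) (T.iter i ω x : X)) := by
  refine ⟨n, ?_⟩
  rintro _ ⟨x, rfl⟩
  simpa using Finset.sum_le_card_nsmul (Finset.range n) _ (1 : ℝ) fun i _ =>
    indicator_le_self' (fun _ _ => zero_le_one) (T.iter i ω x : X)

theorem maxVisits_nonneg (E : Set X) (n : ℕ) (ω : Ω) : 0 ≤ T.maxVisits E n ω :=
  Real.iSup_nonneg fun _ => Finset.sum_nonneg fun _ _ => indicator_nonneg (fun _ _ => zero_le_one) _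

theorem maxVisits_mono {E E' : Set X} (h : E ⊆ E') (n : ℕ) (ω : Ω) :
    T.maxVisits E n ω ≤ T.maxVisits E' n ω :=
  ciSup_mono (T.bddAbove_visits E' n ω) fun _ => Finset.sum_le_sum fun _ _ =>
    indicator_le_indicator_of_subset h (fun _ => zero_le_one) _

variable {T}

theorem IsSmall.mono {E E' : Set X} (h : E ⊆ E') (hE' : T.IsSmall E') : T.IsSmall E := by
  filter_upwards [hE'] with ω hω
  refine squeeze_zero (fun n => ?_) (fun n => ?_) hω
  · exact mul_nonneg (by positivity) (T.maxVisits_nonneg E n ω)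
  · exact mul_le_mul_of_nonneg_left (T.maxVisits_mono h n ω) (by positivity)

theorem hasOrbitCapacity_zero {E : Set X} {ω : Ω}
    (h : ∀ k : ℕ, ∃ M, ∀ n : ℕ, T.maxVisits E n ω ≤ M + n * (1 / (k + 1))) :
    T.HasOrbitCapacity E ω 0 := by
  refine Metric.tendsto_atTop'.2 fun ε hε => ?_
  obtain ⟨k, hk⟩ := exists_nat_one_div_lt (half_pos hε)
  obtain ⟨M, hM⟩ := h k
  obtain ⟨N, hN⟩ := exists_nat_gt (M / (ε / 2))
  refine ⟨N, fun n hn => ?_⟩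
  have hn0 : (0 : ℝ) < n := by exact_mod_cast (Nat.zero_le N).trans_lt hn
  have hMn : M < n * (ε / 2) := by
    rw [div_lt_iff₀ (half_pos hε)] at hN
    exact hN.trans (by gcongr)
  rw [Real.dist_0_eq_abs, abs_of_nonneg (mul_nonneg (by positivity) (T.maxVisits_nonneg E n ω)),
    one_div, inv_mul_lt_iff₀ hn0]
  have h1 : (n : ℝ) * (1 / (k + 1)) < n * (ε / 2) := by gcongr
  linarith [hM n]

end Visits

variable {Ω : Type*} [MeasurableSpace Ω] {X : Type*} [MetricSpace X] [CompactSpace X]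
  [MeasurableSpace X] [BorelSpace X] {P : Measure Ω} {ϑ : Ω → Ω} {T : BundleRDS X P ϑ}

/-- The number of visits is controlled by averages of maximal Birkhoff sums. -/
theorem mul_maxVisits_le {E : Set X} {f : C(X, ℝ)} (h0 : ∀ x, 0 ≤ f x) (h1 : ∀ x, f x ≤ 1)
    (hE : ∀ x ∈ E, 1 ≤ f x) (m n : ℕ) (ω : Ω) :
    m * T.maxVisits E n ω ≤
      birkhoffSum ϑ (T.fiberSup (birkhoffSum T.skew (T.indicatorMap .univ f).1 m)) n ω + m ^ 2 := by
  have hF : ∀ p, (T.indicatorMap .univ f).1 p = f p.1.2 := fun p => by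
    simp [indicatorMap_apply]
  rw [maxVisits, Real.mul_iSup_of_nonneg (Nat.cast_nonneg m)]
  refine ciSup_le fun x => ?_
  let p : T.graph := ⟨(ω, x), x.2⟩
  obtain ⟨C, hC⟩ := (birkhoffSum_mem (T.indicatorMap .univ f) m).2
  calc (m : ℝ) * ∑ i ∈ Finset.range n, E.indicator (fun _ => (1 : ℝ)) (T.iter i ω x : X)
      ≤ m * birkhoffSum T.skew (T.indicatorMap .univ f).1 n p := by
        refine mul_le_mul_of_nonneg_left (Finset.sum_le_sum fun i _ => ?_) (Nat.cast_nonneg m)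
        rw [hF, T.skew_iterate i ω x]
        exact indicator_le' (fun y hy => hE y hy) (fun y _ => h0 y) _
    _ ≤ birkhoffSum T.skew (birkhoffSum T.skew (T.indicatorMap .univ f).1 m) n p + m ^ 2 :=
        mul_birkhoffSum_le _ (fun p => by rw [hF]; exact h0 _) (fun p => by rw [hF]; exact h1 _) m n p
    _ ≤ _ := by
        gcongr
        refine Finset.sum_le_sum fun i _ => ?_
        have := le_fiberSup (fun p => (abs_le.1 (hC p)).2) (T.skew^[i] p)
        rwa [fst_skew_iterate] at this

variable [IsProbabilityMeasure P] [P.IsComplete]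

/-- For a uniquely ergodic system, the asymptotic maximal average of a continuous function is its
integral. -/
theorem UniquelyErgodic.maxAverage_eq (hT : T.UniquelyErgodic) {μ : Measure (Ω × X)}
    (hμ : μ ∈ T.invariantMeasures) (f : C(X, ℝ)) :
    T.maxAverage (T.indicatorMap .univ f) = ∫ p, f p.2 ∂μ := by
  obtain ⟨Λ, hΛ, hle, hinv⟩ := exists_invariant_functional (T.indicatorMap .univ f)
  obtain ⟨m, hm, hmf⟩ := exists_mem_invariantMeasures hle hinv
  obtain ⟨μ', hμ'⟩ := hT
  rw [hμ', mem_singleton_iff] at hμ hm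
  rw [← hΛ, ← hmf, hm, hμ]

/-- Over an ergodic base, a closed set that is null for the unique invariant measure is small. -/
theorem UniquelyErgodic.isSmall_of_isClosed (hP : Ergodic ϑ P) (hT : T.UniquelyErgodic)
    {μ : Measure (Ω × X)} (hμ : μ ∈ T.invariantMeasures) {E : Set X} (hE : IsClosed E)
    (hE0 : μ (univ ×ˢ E) = 0) : T.IsSmall E := by
  have := hμ.1
  have hsnd : (μ.map Prod.snd) E = 0 := by
    rwa [Measure.map_apply measurable_snd hE.measurableSet, ← univ_prod]
  have hprob : IsProbabilityMeasure (μ.map Prod.snd) :=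
    Measure.isProbabilityMeasure_map measurable_snd.aemeasurable
  have hk : ∀ k : ℕ, ∀ᵐ ω ∂P, ∃ M, ∀ n : ℕ, T.maxVisits E n ω ≤ M + n * (1 / (k + 1)) := by
    intro k
    have hε : (0 : ℝ) < 1 / (k + 1) := Nat.one_div_pos_of_nat
    obtain ⟨f, h0, h1, hfE, hfi⟩ : ∃ f : C(X, ℝ), (∀ x, 0 ≤ f x) ∧ (∀ x, f x ≤ 1) ∧
        (∀ x ∈ E, 1 ≤ f x) ∧ ∫ p, f p.2 ∂μ < 1 / (k + 1) := by
      -- Since `E` is closed, thickened indicators decrease to its indicator, and their integrals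
      -- tend to the measure of `E`, which is zero.
      have htend := tendsto_lintegral_thickenedIndicator_of_isClosed (μ.map Prod.snd) hE
        (fun n => Nat.one_div_pos_of_nat) tendsto_one_div_add_atTop_nhds_zero_nat
      rw [hsnd] at htend
      obtain ⟨n, hn⟩ := (htend.eventually_lt_const (ENNReal.ofReal_pos.2 hε)).exists
      let g := thickenedIndicator (Nat.one_div_pos_of_nat (α := ℝ) (n := n)) E
      refine ⟨⟨fun x => (g x : ℝ), NNReal.continuous_coe.comp g.continuous⟩, fun x => (g x).2,
        fun x => by exact_mod_cast thickenedIndicator_le_one _ E x,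
        fun x hx => by exact_mod_cast (thickenedIndicator_one _ E hx).ge, ?_⟩
      change ∫ p, (g p.2 : ℝ) ∂μ < _
      rw [← integral_map (f := fun x => (g x : ℝ)) measurable_snd.aemeasurable
        (NNReal.continuous_coe.comp g.continuous).measurable.aestronglyMeasurable,
        integral_eq_lintegral_of_nonneg_ae (f := fun x => (g x : ℝ)) (ae_of_all _ fun x => (g x).2)
        (NNReal.continuous_coe.comp g.continuous).measurable.aestronglyMeasurable]
      simp only [ENNReal.ofReal_coe_nnreal]
      exact (ENNReal.lt_ofReal_iff_toReal_lt hn.ne_top).1 hn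
    have hlim := tendsto_maxAverage (T.indicatorMap .univ f)
    rw [hT.maxAverage_eq hμ f] at hlim
    obtain ⟨m, hm, hm0⟩ := ((hlim.eventually_lt_const hfi).and (eventually_gt_atTop 0)).exists
    have hm0' : (0 : ℝ) < m := by exact_mod_cast hm0
    rw [div_lt_iff₀ hm0'] at hm
    obtain ⟨C, hC⟩ := (birkhoffSum_mem (T.indicatorMap .univ f) m).2
    -- The maximal sum over a block of length `m` has mean below `m / (k + 1)`. After division by
    -- `m`, the error `m ^ 2` is absorbed in the constant.
    filter_upwards [hP.ae_eventually_birkhoffSum_le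
      (measurable_fiberSup ⟨_, birkhoffSum_mem (T.indicatorMap .univ f) m⟩) (abs_fiberSup_le hC) hm]
      with ω ⟨M, hM⟩
    refine ⟨(M + m ^ 2) / m, fun n => ?_⟩
    have h2 := (mul_maxVisits_le h0 h1 hfE m n ω).trans (add_le_add_left (hM n) _)
    rw [mul_comm, ← le_div_iff₀ hm0'] at h2
    refine h2.trans (le_of_eq ?_)
    field_simp
    ring
  filter_upwards [ae_all_iff.2 hk] with ω hω
  exact hasOrbitCapacity_zero hω

end BundleRDS

/-! ### Spheres, balls and the small boundary property. -/

theorem mainTheorem7 {Ω : Type*} [MeasurableSpace Ω] {X : Type*} [MetricSpace X]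
    [CompactSpace X] [MeasurableSpace X] [BorelSpace X]
    (P : Measure Ω) [IsProbabilityMeasure P] [P.IsComplete] (ϑ : Ω → Ω)
    (T : BundleRDS X P ϑ) (hP : Ergodic ϑ P) (hT : T.UniquelyErgodic) :
    T.HasSBP ∧
      ∀ x : X,
        (∀ μ ∈ T.invariantMeasures,
          {r : ℝ | 0 < r ∧ μ (Set.univ ×ˢ Metric.sphere x r) ≠ 0}.Countable) ∧
        {r : ℝ | 0 < r ∧ ¬ T.IsSmall (Metric.sphere x r)}.Countable ∧
        ∀ ε : ℝ, 0 < ε → ∃ r : ℝ, 0 < r ∧ r < ε ∧ T.IsSmall (frontier (Metric.ball x r)) := by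
  obtain ⟨μ, hμ⟩ : ∃ μ, μ ∈ T.invariantMeasures := by
    obtain ⟨μ, h⟩ := hT
    exact ⟨μ, h ▸ mem_singleton μ⟩
  have hcount : ∀ x : X, {r : ℝ | 0 < r ∧ ¬ T.IsSmall (Metric.sphere x r)}.Countable := fun x => by
    have := hμ.1
    refine (μ.countable_setOf_sphere_ne_zero x).mono ?_
    rintro r ⟨hr, hs⟩
    refine ⟨hr, fun h0 => hs ?_⟩
    exact (hT.isSmall_of_isClosed hP hμ Metric.isClosed_sphere h0)
  have hball : ∀ (x : X) (ε : ℝ), 0 < ε →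
      ∃ r : ℝ, 0 < r ∧ r < ε ∧ T.IsSmall (frontier (Metric.ball x r)) := by
    intro x ε hε
    -- The interval is uncountable and the exceptional radii are countable.
    obtain ⟨r, hr, hr'⟩ : (Ioo 0 ε \ {r : ℝ | 0 < r ∧ ¬ T.IsSmall (Metric.sphere x r)}).Nonempty := by
      by_contra hne
      rw [not_nonempty_iff_eq_empty, sdiff_eq_empty] at hne
      exact (not_le.2 hε) (Cardinal.Real.Ioo_countable_iff.1 ((hcount x).mono hne))
    refine ⟨r, hr.1, hr.2, BundleRDS.IsSmall.mono Metric.frontier_ball_subset_sphere ?_⟩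
    by_contra hs
    exact hr' ⟨hr.1, hs⟩
  refine ⟨fun x U hU hx => ?_, fun x => ⟨fun ν hν => ?_, hcount x, hball x⟩⟩
  · obtain ⟨ε, hε, hεU⟩ := Metric.isOpen_iff.1 hU x hx
    obtain ⟨r, hr, hrε, hs⟩ := hball x ε hε
    exact ⟨Metric.ball x r, Metric.ball_mem_nhds x hr, (Metric.ball_subset_ball hrε.le).trans hεU, hs⟩
  · have := hν.1
    exact ν.countable_setOf_sphere_ne_zero x
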